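/- Conventions. For $d\ge 0$ let $\mathbb C^{2d}$ carry its nondegenerate metric $g$, let $S=\Lambda^\bullet(\mathbb C^d)$ be the spinor module with Clifford multiplication normalised by $uv+vu=g(u,v)$, let $S^+$ be the even forms, and for a spinor $\psi$ let $M(\psi)=\{u\in\mathbb C^{2d}: u\psi=0\}$ be its annihilator; $\psi\neq 0$ is pure if $\dim M(\psi)=d$. A canonical basis of $\mathbb C^{2d}$ is a basis $(b_i,\bar b_i)_{1\le i\le d}$ with $g(b_i,b_j)=g(\bar b_i,\bar b_j)=0$ and $g(b_i,\bar b_j)=\delta_{ij}$. A configuration of $k$ pure spinors is a family $\psi_1,\dots,\psi_k\in S^+$ such that (i) for one canonical basis $(a_i,a_i^\dagger)$ and one nonzero $\psi_0\in S^+$ with $a_i\psi_0=0$ for all $i$, each $\psi_\alpha$ is a product of an even number of distinct creation operators $a_i^\dagger$ applied to $\psi_0$, and (ii) $\dim(M(\psi_\alpha)\cap M(\psi_\beta))\le d-4$ for $\alpha\ne\beta$. For a spinor $\psi$ let $B_2(\psi)(u,v)=\tfrac12\langle\psi,(uv-vu)\psi\rangle$, where $\langle\psi,\phi\rangle$ is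 the coefficient of $e^{1\cdots d}$ in $\psi\wedge\sigma(\phi)$, $\sigma$ being the reversal of forms; vectors are identified with 1-forms by $g$. Theorem. (1) Let $\psi_1,\dots,\psi_4$ be a configuration of four pure spinors for $d=6$. Then $\dim (M(\psi_\alpha)\cap M(\psi_\beta))=2$ for all $\alpha\neq\beta$, and $M(\psi_\alpha)\cap M(\psi_\beta)\cap M(\psi_\gamma)=0$ for distinct $\alpha,\beta,\gamma$; in particular the four annihilators have no common direction. For all nonzero $c_1,\dots,c_4\in\mathbb C$ the spinor $\psi=\sum_\alpha c_\alpha\psi_\alpha$ satisfies: (a) there are a canonical basis $(b_i,\bar b_i)$ of $\mathbb C^{12}$ and $\mu\ne 0$ with $B_2(\psi)=\mu\sum_{i=1}^6\bar b_i\wedge b_i$; (b) for all pure $\phi_A,\phi_B\in S^+$ with $M(\phi_A)\cap M(\phi_B)=0$ there are $s\in\mathbb C\setminus\{0\}$ and $g\in\mathrm{Spin}(12,\mathbb C)$ with $g\psi=s(\phi_A+\phi_B)$. Thus, up to scale, $\psi$ lies in the $\mathrm{Spin}(12,\mathbb C)$-orbit of the impurity-two spinor with complementary annihilators. (2) If $d=6$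 and $\phi_A,\phi_B\in S^+$ are pure with $M(\phi_A)\cap M(\phi_B)=0$, then the stabiliser of $\phi_A+\phi_B$ in $\mathrm{Spin}(12,\mathbb C)$ is isomorphic to $\mathrm{SL}(6,\mathbb C)$. More precisely, for some canonical basis $(a_i,a_i^\dagger)$ in which the $a_i$ span $M(\phi_A)$ and the $a_i^\dagger$ span $M(\phi_B)$, there is an isomorphism under which $h\in \mathrm{SL}(6,\mathbb C)$ acts on vectors by $a_i\mapsto\sum_j h_{ji}a_j$, $a_i^\dagger\mapsto\sum_j (h^{-1})_{ij}a_j^\dagger$. (3) Let $d$ and $k$ be arbitrary, let $\psi_1,\dots,\psi_k$ be a configuration, and let $c_1,\dots,c_k\ne0$. Suppose that $\sum_\alpha c_\alpha\psi_\alpha$ is irreducible, i.e. no spinor in its $\mathrm{Spin}(2d,\mathbb C)$-orbit is a linear combination of fewer than $k$ pure spinors of $S^+$ whose annihilators pairwise meet in at most $d-4$ dimensions. Then for any four distinct indices the tetrahedral intersection number $t=\dim(M(\psi_\alpha)\cap M(\psi_\beta)\cap M(\psi_\gamma)\cap M(\psi_\delta))$ satisfies $t\le d-7$. -/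

import Mathlib

noncomputable section

namespace SpinorOrbits

open CliffordAlgebra

/-! ### The quadratic space, the spinors and the Clifford action -/

/-- The space `ℂ^{2d}`, split as the sum of two complementary totally null subspaces. -/
abbrev V (d : ℕ) : Type := Module.Dual ℂ (Fin d → ℂ) × (Fin d → ℂ)

/-- The nondegenerate quadratic form `Q (f, x) = f x` on `ℂ^{2d}`. -/
abbrev Q (d : ℕ) : QuadraticForm ℂ (V d) := QuadraticForm.dualProd ℂ (Fin d → ℂ)

/-- The metric `g`, normalised by the Clifford relation `u v + v u = g(u, v)`. -/
abbrev metric (d : ℕ) (u v : V d) : ℂ := QuadraticMap.polar (Q d) u v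

/-- The space of (Dirac) spinors `S = Λ^•(ℂ^d)`. -/
abbrev Spinor (d : ℕ) : Type := ExteriorAlgebra ℂ (Fin d → ℂ)

/-- The semi-spinors `S⁺`: the forms of even degree. -/
def semiSpinor (d : ℕ) : Submodule ℂ (Spinor d) :=
  evenOdd (0 : QuadraticForm ℂ (Fin d → ℂ)) 0

/-- Clifford multiplication by a vector `(f, x)`: contraction with `f` plus exterior
multiplication by `x`. -/
def vectorAct (d : ℕ) : V d →ₗ[ℂ] Module.End ℂ (Spinor d) :=
  (contractLeft (Q := (0 : QuadraticForm ℂ (Fin d → ℂ)))).comp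
      (LinearMap.fst ℂ (Module.Dual ℂ (Fin d → ℂ)) (Fin d → ℂ)) +
    ((LinearMap.mul ℂ (Spinor d)).comp (ExteriorAlgebra.ι ℂ)).comp
      (LinearMap.snd ℂ (Module.Dual ℂ (Fin d → ℂ)) (Fin d → ℂ))

theorem vectorAct_apply (d : ℕ) (v : V d) (ψ : Spinor d) :
    vectorAct d v ψ =
      contractLeft (Q := (0 : QuadraticForm ℂ (Fin d → ℂ))) v.1 ψ + ExteriorAlgebra.ι ℂ v.2 * ψ :=
  rfl

theorem vectorAct_mul_self (d : ℕ) (v : V d) :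
    vectorAct d v * vectorAct d v = algebraMap ℂ (Module.End ℂ (Spinor d)) (Q d v) := by
  refine LinearMap.ext fun ψ => ?_
  rw [Module.End.mul_apply, Module.algebraMap_end_apply, vectorAct_apply, vectorAct_apply,
    map_add, contractLeft_contractLeft, mul_add]
  have h1 : contractLeft (Q := (0 : QuadraticForm ℂ (Fin d → ℂ))) v.1
      (ExteriorAlgebra.ι ℂ v.2 * ψ) = v.1 v.2 • ψ - ExteriorAlgebra.ι ℂ v.2 *
        contractLeft (Q := (0 : QuadraticForm ℂ (Fin d → ℂ))) v.1 ψ :=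
    contractLeft_ι_mul v.1 v.2 ψ
  have h2 : ExteriorAlgebra.ι ℂ v.2 * (ExteriorAlgebra.ι ℂ v.2 * ψ) = 0 := by
    rw [← mul_assoc, ExteriorAlgebra.ι_sq_zero, zero_mul]
  rw [h1, h2]
  simp

/-- The spinor representation of the Clifford algebra on `S`. -/
def spinorRep (d : ℕ) : CliffordAlgebra (Q d) →ₐ[ℂ] Module.End ℂ (Spinor d) :=
  CliffordAlgebra.lift (Q d) ⟨vectorAct d, vectorAct_mul_self d⟩

/-- The complex spin group `Spin(2d, ℂ)`. -/
abbrev Spin (d : ℕ) : Type := spinGroup (Q d)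

/-- The action of `Spin(2d, ℂ)` on spinors. -/
def spinAct (d : ℕ) (g : Spin d) (ψ : Spinor d) : Spinor d :=
  spinorRep d (g : CliffordAlgebra (Q d)) ψ

/-- The stabiliser of a spinor in `Spin(2d, ℂ)`. -/
def spinStabilizer (d : ℕ) (ψ : Spinor d) : Subgroup (Spin d) where
  carrier := {g | spinAct d g ψ = ψ}
  mul_mem' := by
    intro g h hg hh
    simp only [Set.mem_ofPred_eq, spinAct, Submonoid.coe_mul, map_mul,
      Module.End.mul_apply] at hg hh ⊢
    rw [hh, hg]
  one_mem' := by simp [spinAct]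
  inv_mem' := by
    intro g hg
    simp only [Set.mem_ofPred_eq, spinAct] at hg ⊢
    have h : ((g⁻¹ : Spin d) : CliffordAlgebra (Q d)) * (g : CliffordAlgebra (Q d)) = 1 := by
      rw [← Submonoid.coe_mul, inv_mul_cancel, Submonoid.coe_one]
    calc spinorRep d ((g⁻¹ : Spin d) : CliffordAlgebra (Q d)) ψ
        = spinorRep d ((g⁻¹ : Spin d) : CliffordAlgebra (Q d))
            (spinorRep d (g : CliffordAlgebra (Q d)) ψ) := by rw [hg]
      _ = ψ := by rw [← Module.End.mul_apply, ← map_mul, h, map_one, Module.End.one_apply]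

/-! ### Pure spinors, canonical bases and configurations -/

/-- The annihilator subspace `M(ψ) = {u | u ψ = 0}`. -/
def ann (d : ℕ) (ψ : Spinor d) : Submodule ℂ (V d) :=
  LinearMap.ker ((vectorAct d).flip ψ)

theorem mem_ann {d : ℕ} {ψ : Spinor d} {u : V d} : u ∈ ann d ψ ↔ vectorAct d u ψ = 0 :=
  Iff.rfl

/-- A spinor is pure when its annihilator has the maximal dimension `d`. -/
def IsPure (d : ℕ) (ψ : Spinor d) : Prop :=
  ψ ≠ 0 ∧ Module.finrank ℂ (ann d ψ) = d

/-- `(a, a')` is a canonical basis of `ℂ^{2d}` (`a'` is written `a†` or `ā` on paper); linear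
independence follows from the relations. -/
structure IsCanonicalBasis (d : ℕ) (a a' : Fin d → V d) : Prop where
  null : ∀ i j, metric d (a i) (a j) = 0
  null' : ∀ i j, metric d (a' i) (a' j) = 0
  pairing : ∀ i j, metric d (a i) (a' j) = if i = j then 1 else 0

/-- The basis spinor `a'_{i₁} ⋯ a'_{i_r} ψ₀`, where `I = {i₁ < ⋯ < i_r}`. -/
def basisSpinor (d : ℕ) (a' : Fin d → V d) (ψ₀ : Spinor d) (I : Finset (Fin d)) : Spinor d :=
  (I.sort (· ≤ ·)).foldr (fun i ψ => vectorAct d (a' i) ψ) ψ₀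

/-- The annihilators of the spinors `ψ_α` pairwise intersect in at most `d - 4` dimensions. -/
def SmallEdges (d : ℕ) {k : ℕ} (ψ : Fin k → Spinor d) : Prop :=
  ∀ α β, α ≠ β → Module.finrank ℂ (ann d (ψ α) ⊓ ann d (ψ β) : Submodule ℂ (V d)) + 4 ≤ d

/-- A configuration of `k` pure spinors: all of them are basis spinors of `S⁺` for one canonical
basis `(a, a')` with vacuum `ψ₀ ∈ S⁺`, and any two of their annihilators meet in at most `d - 4`
dimensions. -/
def IsConfiguration (d : ℕ) {k : ℕ} (ψ : Fin k → Spinor d) : Prop :=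
  (∃ (a a' : Fin d → V d) (ψ₀ : Spinor d), IsCanonicalBasis d a a' ∧
    ψ₀ ∈ semiSpinor d ∧ ψ₀ ≠ 0 ∧ (∀ i, vectorAct d (a i) ψ₀ = 0) ∧
    ∃ I : Fin k → Finset (Fin d), ∀ α, Even (I α).card ∧ ψ α = basisSpinor d a' ψ₀ (I α)) ∧
  SmallEdges d ψ

/-- The linear combination `∑ c_α ψ_α` is reducible: its `Spin(2d, ℂ)`-orbit contains a linear
combination of fewer pure spinors of `S⁺`, no two of which have annihilators meeting in more than
`d - 4` dimensions. -/
def IsReducible (d : ℕ) {k : ℕ} (ψ : Fin k → Spinor d) (c : Fin k → ℂ) : Prop :=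
  ∃ m < k, ∃ (φ : Fin m → Spinor d) (b : Fin m → ℂ) (g : Spin d),
    (∀ j, φ j ∈ semiSpinor d ∧ IsPure d (φ j)) ∧ SmallEdges d φ ∧
    spinAct d g (∑ α, c α • ψ α) = ∑ j, b j • φ j

/-! ### The invariant inner product and the 2-form `B₂` -/

/-- The coefficient of `e^1 ∧ ⋯ ∧ e^d` of a form: contract with the dual basis covectors of
`e^1, …, e^d` in this order and keep the scalar part. -/
def topCoeff (d : ℕ) : Spinor d →ₗ[ℂ] ℂ :=
  (ExteriorAlgebra.algebraMapInv (R := ℂ) (M := Fin d → ℂ)).toLinearMap ∘ₗ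
    (List.finRange d).foldl
      (fun F i => (contractLeft (Q := (0 : QuadraticForm ℂ (Fin d → ℂ)))
        (LinearMap.proj i : (Fin d → ℂ) →ₗ[ℂ] ℂ)) ∘ₗ F) LinearMap.id

/-- The invariant inner product `⟨ψ, φ⟩ = (ψ ∧ σ(φ))|_top`, with `σ` the reversal. -/
def inner (d : ℕ) (ψ φ : Spinor d) : ℂ :=
  topCoeff d (ψ * reverse (Q := (0 : QuadraticForm ℂ (Fin d → ℂ))) φ)

/-- The 2-form `B₂(ψ, ψ)`, evaluated on two vectors: `½ ⟨ψ, (u v - v u) ψ⟩`. -/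
def B₂ (d : ℕ) (ψ : Spinor d) (u v : V d) : ℂ :=
  (1 / 2 : ℂ) * (inner d ψ (vectorAct d u (vectorAct d v ψ)) -
    inner d ψ (vectorAct d v (vectorAct d u ψ)))

/-- The 2-form `x ∧ y` evaluated on `(u, v)`; vectors are identified with 1-forms by the
metric. -/
def wedge (d : ℕ) (x y u v : V d) : ℂ :=
  metric d x u * metric d y v - metric d x v * metric d y u

end SpinorOrbits

end

/-!
# Sums of pure spinors, the orbit of two complementary pure spinors, and its stabiliser

A *frame* is a canonical basis `(a, a')` together with a vacuum, a nonzero spinor killed by all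
`a_i`. Everything rests on two facts about frames. The pin group is transitive on canonical bases:
the orthonormal bases `a_i + a'_i`, `√-1 (a_i - a'_i)` are matched vector by vector through
reflections (`IsCanonicalBasis.exists_intertwines`). The vacuum is unique up to scale: this reduces
to the standard basis, where a form killed by all contractions is a scalar because the number
operator acts on the degree-`k` component as `k` (`IsFrame.exists_smul`). Between frames with even
vacua the intertwining element is even, hence in the spin group (`IsFrame.exists_spin`).

**Four summands are two.** Take one member `χ` of a configuration as vacuum. The others arise by
exchanging creation and annihilation operators on sets of indices of size at least four and at
mutual distance at least four. If the annihilators of four members share at least `d - 6`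
dimensions, three of these sets lie in a set of size six, so they are the unions of two out of three
disjoint pairs (`exists_pairs`). With `P₁, P₂, P₃` the products of two creation operators in these
pairs, the four spinors are proportional to `χ`, `P₂P₃χ`, `P₁P₃χ`, `P₁P₂χ`, and any combination of
them with nonzero coefficients is a multiple of `e^ω χ + e^{-ω} χ` for a suitable
`ω = x P₁ + y P₂ + z P₃`, since the bivectors `P_m` commute and square to zero. The spinors
`e^{± ω} χ` are vacua of sheared canonical bases, hence pure, and their annihilators meet in at most
`d - 6` dimensions (`exists_two_summands`). Their annihilators also meet those of the remaining
members in at most `d - 4` dimensions, so four such members make a combination reducible: this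
bounds the tetrahedral intersection numbers (`IsConfiguration.isReducible`). For `d = 6` the
hypothesis on the four annihilators is void and the two summands are complementary
(`IsConfiguration.exists_eq_add`).

**Complementary pairs.** By transitivity on frames, a complementary pair is carried to multiples of
`1` and `e^1 ∧ ⋯ ∧ e^d`; a torus element equalises the two scalars
(`exists_spinAct_eq_one_topForm`). In twelve dimensions the inner product is invariant under the
spin group, so `B₂` is equivariant (`B₂_spinAct`) and need only be computed on
`1 + e^1 ∧ ⋯ ∧ e^6`, where it is `(u, v) ↦ u.1 v.2 - v.1 u.2`.

**The stabiliser.** An element fixing `1 + e^1 ∧ ⋯ ∧ e^6` preserves both this 2-form and the metric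
`u.1 v.2 + v.1 u.2`, hence each of the two null subspaces, and by uniqueness of the vacuum each of
the two summands. Its matrix on the span of the `e_i*` has determinant one because it fixes the top
form. The resulting homomorphism to `SL(6)` is injective, as an even Clifford element commuting with
all vectors is a scalar. It is surjective: a matrix of determinant one gives a second canonical
basis with the same vacuum `1`, hence a spin element scaling both summands by one factor `r`; the
invariant inner product gives `r = ± 1`, and `-1` lies in the spin group
(`stabilizerToSL_surjective`).
-/

noncomputable section

namespace SpinorOrbits

open CliffordAlgebra

/-! ### Contractions and the number operator -/

section Contraction

variable {M : Type*} [AddCommGroup M] [Module ℂ M]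

/-- The number operator `∑ i, b_i ∧ (b_i* ⌋ ·)` of the exterior algebra. -/
def numberOp {n : Type*} [Fintype n] (b : Module.Basis n ℂ M) :
    Module.End ℂ (ExteriorAlgebra ℂ M) :=
  ∑ i, LinearMap.mulLeft ℂ (ExteriorAlgebra.ι ℂ (b i)) ∘ₗ
    contractLeft (Q := (0 : QuadraticForm ℂ M)) (b.coord i)

theorem numberOp_apply {n : Type*} [Fintype n] (b : Module.Basis n ℂ M)
    (x : ExteriorAlgebra ℂ M) : numberOp b x = ∑ i, ExteriorAlgebra.ι ℂ (b i) *
      contractLeft (Q := (0 : QuadraticForm ℂ M)) (b.coord i) x := by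
  simp [numberOp, LinearMap.sum_apply]

theorem contractLeft_extι_mul (f : Module.Dual ℂ M) (v : M) (x : ExteriorAlgebra ℂ M) :
    contractLeft (Q := (0 : QuadraticForm ℂ M)) f (ExteriorAlgebra.ι ℂ v * x) =
      f v • x - ExteriorAlgebra.ι ℂ v * contractLeft (Q := (0 : QuadraticForm ℂ M)) f x :=
  contractLeft_ι_mul f v x

theorem extι_mul_anticomm (v w : M) (x : ExteriorAlgebra ℂ M) :
    ExteriorAlgebra.ι ℂ v * (ExteriorAlgebra.ι ℂ w * x) =
      -(ExteriorAlgebra.ι ℂ w * (ExteriorAlgebra.ι ℂ v * x)) := by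
  rw [← mul_assoc, ← mul_assoc, eq_neg_iff_add_eq_zero, ← add_mul,
    ExteriorAlgebra.ι_add_mul_swap, zero_mul]

theorem numberOp_ι_mul {n : Type*} [Fintype n] (b : Module.Basis n ℂ M) (v : M)
    (x : ExteriorAlgebra ℂ M) : numberOp b (ExteriorAlgebra.ι ℂ v * x) =
      ExteriorAlgebra.ι ℂ v * x + ExteriorAlgebra.ι ℂ v * numberOp b x := by
  have hv : ExteriorAlgebra.ι ℂ v = ∑ i, b.coord i v • ExteriorAlgebra.ι ℂ (b i) := by
    simp_rw [← map_smul, ← map_sum, Module.Basis.coord_apply, b.sum_repr]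
  rw [numberOp_apply, numberOp_apply, Finset.mul_sum]
  simp_rw [contractLeft_extι_mul, mul_sub, extι_mul_anticomm _ v]
  rw [Finset.sum_sub_distrib, Finset.sum_neg_distrib, sub_neg_eq_add]
  congr 1
  conv_rhs => rw [hv]
  rw [Finset.sum_mul]
  exact Finset.sum_congr rfl fun i _ => by rw [mul_smul_comm, smul_mul_assoc]

theorem numberOp_of_mem {n : Type*} [Fintype n] (b : Module.Basis n ℂ M) (k : ℕ)
    {x : ExteriorAlgebra ℂ M} (hx : x ∈ ⋀[ℂ]^k M) : numberOp b x = (k : ℂ) • x := by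
  induction k generalizing x with
  | zero =>
    have h : x ∈ (1 : Submodule ℂ (ExteriorAlgebra ℂ M)) := by simpa using hx
    obtain ⟨r, rfl⟩ := Submodule.mem_one.1 h
    rw [numberOp_apply]
    have h0 : ∀ i, contractLeft (Q := (0 : QuadraticForm ℂ M)) (b.coord i)
        (algebraMap ℂ (ExteriorAlgebra ℂ M) r) = 0 := fun i => contractLeft_algebraMap _ _ r
    simp [h0]
  | succ k ih =>
    have h : x ∈ LinearMap.range (ExteriorAlgebra.ι ℂ : M →ₗ[ℂ] _) * ⋀[ℂ]^k M := by
      rw [← pow_succ']; exact hx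
    refine Submodule.mul_induction_on h ?_ ?_
    · rintro _ ⟨v, rfl⟩ y hy
      rw [numberOp_ι_mul, ih hy, mul_smul_comm, Nat.cast_succ, add_smul, one_smul, add_comm]
    · intro y z hy hz
      rw [map_add, hy, hz, smul_add]

/-- An exterior form killed by all contractions is a scalar: the number operator kills it, and acts
on the component of degree `k` as multiplication by `k`. -/
theorem mem_range_algebraMap_of_contractLeft_eq_zero {n : Type*} [Fintype n]
    (b : Module.Basis n ℂ M) {x : ExteriorAlgebra ℂ M}
    (hx : ∀ i, contractLeft (Q := (0 : QuadraticForm ℂ M)) (b.coord i) x = 0) :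
    ∃ r : ℂ, x = algebraMap ℂ _ r := by
  classical
  have hN : numberOp b x = 0 := by simp [numberOp_apply, hx]
  have key : ∀ (y : ExteriorAlgebra ℂ M) (k : ℕ),
      GradedRing.proj (fun i : ℕ => ⋀[ℂ]^i M) k (numberOp b y) =
        (k : ℂ) • GradedRing.proj (fun i : ℕ => ⋀[ℂ]^i M) k y := by
    intro y k
    induction y using DirectSum.Decomposition.inductionOn (fun i : ℕ => ⋀[ℂ]^i M) with
    | zero => simp
    | @homogeneous i m =>
      rw [numberOp_of_mem b i m.2, GradedRing.proj_apply, GradedRing.proj_apply,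
        DirectSum.decompose_smul]
      rw [DirectSum.smul_apply, Submodule.coe_smul]
      by_cases h : i = k
      · subst h; rfl
      · rw [DirectSum.decompose_of_mem_ne (fun i : ℕ => ⋀[ℂ]^i M) m.2 h, smul_zero, smul_zero]
    | add y z hy hz => rw [map_add, map_add, hy, hz, map_add, smul_add]
  have h0 : ∀ k : ℕ, k ≠ 0 → GradedRing.proj (fun i : ℕ => ⋀[ℂ]^i M) k x = 0 := by
    intro k hk
    have := key x k
    rw [hN, map_zero] at this
    exact (smul_eq_zero.1 this.symm).resolve_left (Nat.cast_ne_zero.2 hk)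
  have hmem : x ∈ ⋀[ℂ]^0 M := by
    have hs := DirectSum.sum_support_decompose (fun i : ℕ => ⋀[ℂ]^i M) x
    rw [← hs]
    refine Submodule.sum_mem _ fun k _ => ?_
    by_cases hk : k = 0
    · subst hk; exact Subtype.prop _
    · have := h0 k hk
      rw [GradedRing.proj_apply] at this
      rw [this]; exact Submodule.zero_mem _
  have h : x ∈ (1 : Submodule ℂ (ExteriorAlgebra ℂ M)) := by simpa using hmem
  obtain ⟨r, hr⟩ := Submodule.mem_one.1 h
  exact ⟨r, hr.symm⟩

variable (Q' : QuadraticForm ℂ M)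

/-- The graded commutator with a vector is the contraction with its metric dual. -/
theorem ι_mul_sub_involute_mul_ι (v : M) (x : CliffordAlgebra Q') :
    ι Q' v * x - involute x * ι Q' v =
      contractLeft (QuadraticMap.polarBilin Q' v) x := by
  induction x using CliffordAlgebra.left_induction with
  | algebraMap r => simp [Algebra.commutes]
  | add x y hx hy => rw [map_add, map_add, ← hx, ← hy]; noncomm_ring
  | ι_mul x w hx =>
    rw [contractLeft_ι_mul, ← hx, map_mul, involute_ι]
    have h : ι Q' v * ι Q' w = algebraMap ℂ _ (QuadraticMap.polar Q' v w) - ι Q' w * ι Q' v := by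
      rw [eq_sub_iff_add_eq, ι_mul_ι_add_swap]
    rw [← mul_assoc, h, QuadraticMap.polarBilin_apply_apply, sub_mul, ← Algebra.smul_def]
    noncomm_ring

/-- For a nondegenerate form, an even element commuting with all vectors is a scalar. -/
theorem mem_range_algebraMap_of_commute {n : Type*} [Fintype n] (b : Module.Basis n ℂ M)
    (hQ : Function.Surjective (QuadraticMap.polarBilin Q')) {x : CliffordAlgebra Q'}
    (hx : involute x = x) (hc : ∀ v, ι Q' v * x = x * ι Q' v) :
    ∃ r : ℂ, x = algebraMap ℂ _ r := by
  have hz : ∀ f : Module.Dual ℂ M, contractLeft f x = 0 := by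
    intro f
    obtain ⟨v, rfl⟩ := hQ f
    rw [← ι_mul_sub_involute_mul_ι, hx, hc, sub_self]
  obtain ⟨r, hr⟩ := mem_range_algebraMap_of_contractLeft_eq_zero b (x := equivExterior Q' x) (by
    intro i
    have := changeForm_contractLeft (changeForm.associated_neg_proof (Q := Q')) (b.coord i) x
    rw [hz, map_zero] at this
    exact this.symm)
  refine ⟨r, (equivExterior Q').injective ?_⟩
  rw [hr]
  exact (changeForm_algebraMap (changeForm.associated_neg_proof (Q := Q')) r).symm

end Contraction

/-! ### The metric and canonical bases -/

theorem metric_apply (d : ℕ) (u v : V d) : metric d u v = u.1 v.2 + v.1 u.2 := by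
  simp only [metric, QuadraticMap.polar, QuadraticForm.dualProd_apply, Prod.fst_add, Prod.snd_add,
    map_add, LinearMap.add_apply]
  ring

theorem metric_comm (d : ℕ) (u v : V d) : metric d u v = metric d v u :=
  QuadraticMap.polar_comm _ _ _

theorem metric_add_left (d : ℕ) (u v w : V d) :
    metric d (u + v) w = metric d u w + metric d v w :=
  QuadraticMap.polar_add_left (Q d) _ _ _

theorem metric_add_right (d : ℕ) (u v w : V d) :
    metric d u (v + w) = metric d u v + metric d u w :=
  QuadraticMap.polar_add_right (Q d) _ _ _

theorem metric_sub_left (d : ℕ) (u v w : V d) :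
    metric d (u - v) w = metric d u w - metric d v w :=
  QuadraticMap.polar_sub_left (Q d) _ _ _

theorem metric_sub_right (d : ℕ) (u v w : V d) :
    metric d u (v - w) = metric d u v - metric d u w :=
  QuadraticMap.polar_sub_right (Q d) _ _ _

theorem metric_smul_left (d : ℕ) (r : ℂ) (u v : V d) :
    metric d (r • u) v = r * metric d u v :=
  QuadraticMap.polar_smul_left (Q d) r u v

theorem metric_smul_right (d : ℕ) (r : ℂ) (u v : V d) :
    metric d u (r • v) = r * metric d u v :=
  QuadraticMap.polar_smul_right (Q d) r u v

theorem metric_sum_left (d : ℕ) {n : Type*} (s : Finset n) (f : n → V d) (v : V d) :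
    metric d (∑ i ∈ s, f i) v = ∑ i ∈ s, metric d (f i) v :=
  (congrArg (fun L : Module.Dual ℂ (V d) => L v)
    (map_sum (QuadraticMap.polarBilin (Q d)) f s)).trans (LinearMap.sum_apply _ _ _)

theorem metric_sum_right (d : ℕ) {n : Type*} (s : Finset n) (f : n → V d) (v : V d) :
    metric d v (∑ i ∈ s, f i) = ∑ i ∈ s, metric d v (f i) :=
  map_sum (QuadraticMap.polarBilin (Q d) v) f s

theorem metric_self (d : ℕ) (u : V d) : metric d u u = 2 * Q d u := by
  rw [metric, QuadraticMap.polar_self, two_smul, two_mul]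

theorem eq_zero_of_metric_eq_zero (d : ℕ) {u : V d} (h : ∀ v, metric d u v = 0) : u = 0 := by
  refine Prod.ext ?_ ?_
  · refine LinearMap.ext fun x => ?_
    simpa [metric_apply] using h (0, x)
  · funext i
    simpa [metric_apply] using h (LinearMap.proj i, 0)

theorem finrank_V (d : ℕ) : Module.finrank ℂ (V d) = 2 * d := by
  rw [Module.finrank_prod, Subspace.dual_finrank_eq, Module.finrank_fin_fun, two_mul]

theorem polarBilin_surjective (d : ℕ) :
    Function.Surjective (QuadraticMap.polarBilin (Q d)) := by
  refine (LinearMap.injective_iff_surjective_of_finrank_eq_finrank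
    (Subspace.dual_finrank_eq (K := ℂ) (V := V d)).symm).1 ?_
  refine (injective_iff_map_eq_zero _).2 fun u hu => ?_
  exact eq_zero_of_metric_eq_zero d fun v => LinearMap.congr_fun hu v

/-- The dual basis covectors `e_i*`, as vectors of `ℂ^{2d}`. -/
def stdA (d : ℕ) (i : Fin d) : V d := (LinearMap.proj i, 0)

/-- The basis vectors `e_i` of `ℂ^d`, as vectors of `ℂ^{2d}`. -/
def stdB (d : ℕ) (i : Fin d) : V d := (0, Pi.single i 1)

theorem isCanonicalBasis_std (d : ℕ) : IsCanonicalBasis d (stdA d) (stdB d) where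
  null i j := by simp [metric_apply, stdA]
  null' i j := by simp [metric_apply, stdB]
  pairing i j := by simp [metric_apply, stdA, stdB, Pi.single_apply]

namespace IsCanonicalBasis

variable {d : ℕ} {a a' : Fin d → V d} (h : IsCanonicalBasis d a a')
include h

theorem pairing' (i j : Fin d) : metric d (a' i) (a j) = if i = j then 1 else 0 := by
  rw [metric_comm, h.pairing]; simp only [eq_comm]

theorem symm : IsCanonicalBasis d a' a where
  null := h.null'
  null' := h.null
  pairing := h.pairing'

theorem metric_sum_smul (c e : Fin d → ℂ) (j : Fin d) :
    metric d (∑ i, (c i • a i + e i • a' i)) (a j) = e j ∧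
      metric d (∑ i, (c i • a i + e i • a' i)) (a' j) = c j := by
  simp only [metric_sum_left, metric_add_left, metric_smul_left, h.null, h.null', h.pairing,
    h.pairing']
  simp

theorem linearIndependent : LinearIndependent ℂ (Sum.elim a a') := by
  rw [Fintype.linearIndependent_iff]
  intro g hg
  have hs : ∑ i, (g (Sum.inl i) • a i + g (Sum.inr i) • a' i) = 0 := by
    rw [Finset.sum_add_distrib, ← hg, Fintype.sum_sum_type]; rfl
  have h0 : ∀ v : V d, metric d 0 v = 0 := fun v => QuadraticMap.polar_zero_left (Q d) v
  rintro (j | j)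
  · have := (h.metric_sum_smul (fun i => g (Sum.inl i)) (fun i => g (Sum.inr i)) j).2
    rw [hs, h0] at this; exact this.symm
  · have := (h.metric_sum_smul (fun i => g (Sum.inl i)) (fun i => g (Sum.inr i)) j).1
    rw [hs, h0] at this; exact this.symm

theorem span_eq_top : Submodule.span ℂ (Set.range (Sum.elim a a')) = ⊤ := by
  refine h.linearIndependent.span_eq_top_of_card_eq_finrank' ?_
  rw [finrank_V, Fintype.card_sum, Fintype.card_fin, two_mul]

theorem eq_zero {u : V d} (h1 : ∀ i, metric d u (a i) = 0) (h2 : ∀ i, metric d u (a' i) = 0) :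
    u = 0 := by
  refine eq_zero_of_metric_eq_zero d fun v => ?_
  have hv : v ∈ Submodule.span ℂ (Set.range (Sum.elim a a')) := by
    rw [h.span_eq_top]; trivial
  have hle : Submodule.span ℂ (Set.range (Sum.elim a a')) ≤
      LinearMap.ker (QuadraticMap.polarBilin (Q d) u) := by
    rw [Submodule.span_le]
    rintro _ ⟨i | i, rfl⟩
    · exact h1 i
    · exact h2 i
  exact hle hv

theorem expand (u : V d) :
    u = ∑ i, (metric d u (a' i) • a i + metric d u (a i) • a' i) := by
  rw [← sub_eq_zero]
  refine h.eq_zero (fun j => ?_) (fun j => ?_)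
  · rw [metric_sub_left, (h.metric_sum_smul _ _ j).1, sub_self]
  · rw [metric_sub_left, (h.metric_sum_smul _ _ j).2, sub_self]

theorem mem_span_iff {u : V d} :
    u ∈ Submodule.span ℂ (Set.range a) ↔ ∀ i, metric d u (a i) = 0 := by
  constructor
  · intro hu i
    have hle : Submodule.span ℂ (Set.range a) ≤
        LinearMap.ker ((QuadraticMap.polarBilin (Q d)).flip (a i)) := by
      rw [Submodule.span_le]
      rintro _ ⟨j, rfl⟩
      exact h.null j i
    exact hle hu
  · intro hu
    rw [h.expand u]
    refine Submodule.sum_mem _ fun i _ => ?_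
    rw [hu i, zero_smul, add_zero]
    exact Submodule.smul_mem _ _ (Submodule.subset_span ⟨i, rfl⟩)

theorem linearIndependent_left : LinearIndependent ℂ a :=
  h.linearIndependent.comp Sum.inl Sum.inl_injective

theorem finrank_span : Module.finrank ℂ (Submodule.span ℂ (Set.range a)) = d := by
  rw [finrank_span_eq_card h.linearIndependent_left, Fintype.card_fin]

/-- A subspace of the span of the `a_i`, all of whose elements have vanishing coordinates at the
indices of `J`, has codimension at least `|J|` in that span. -/
theorem finrank_add_card_le (W : Submodule ℂ (V d)) (J : Finset (Fin d))
    (h1 : ∀ u ∈ W, ∀ i, metric d u (a i) = 0)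
    (h2 : ∀ u ∈ W, ∀ i ∈ J, metric d u (a' i) = 0) :
    Module.finrank ℂ W + J.card ≤ d := by
  classical
  let L : W →ₗ[ℂ] ((Jᶜ : Finset (Fin d)) → ℂ) :=
    LinearMap.pi fun i => (QuadraticMap.polarBilin (Q d)).flip (a' i) ∘ₗ W.subtype
  have hL : Function.Injective L := by
    refine (injective_iff_map_eq_zero L).2 fun u hu => Subtype.ext ?_
    refine h.eq_zero (h1 u u.2) fun i => ?_
    by_cases hi : i ∈ J
    · exact h2 u u.2 i hi
    · exact congrFun hu ⟨i, Finset.mem_compl.2 hi⟩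
  have := LinearMap.finrank_le_finrank_of_injective hL
  rw [Module.finrank_fintype_fun_eq_card, Fintype.card_coe, Finset.card_compl,
    Fintype.card_fin] at this
  have hJ := J.card_le_univ
  rw [Fintype.card_fin] at hJ
  omega

/-- A subspace containing the `a_i` with `i ∉ J` has dimension at least `d - |J|`. -/
theorem le_finrank_add_card (W : Submodule ℂ (V d)) (J : Finset (Fin d))
    (hW : ∀ i ∉ J, a i ∈ W) : d ≤ Module.finrank ℂ W + J.card := by
  classical
  have hli : LinearIndependent ℂ fun i : (Jᶜ : Finset (Fin d)) =>
      (⟨a i, hW i (Finset.mem_compl.1 i.2)⟩ : W) := by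
    refine LinearIndependent.of_comp W.subtype ?_
    exact h.linearIndependent_left.comp _ Subtype.val_injective
  have := hli.fintype_card_le_finrank
  rw [Fintype.card_coe, Finset.card_compl, Fintype.card_fin] at this
  omega

end IsCanonicalBasis

/-! ### Vectors acting on spinors -/

theorem vectorAct_vectorAct_self (d : ℕ) (u : V d) (ψ : Spinor d) :
    vectorAct d u (vectorAct d u ψ) = Q d u • ψ := by
  rw [← Module.End.mul_apply, vectorAct_mul_self, Module.algebraMap_end_apply]

theorem vectorAct_anticomm (d : ℕ) (u v : V d) (ψ : Spinor d) :
    vectorAct d u (vectorAct d v ψ) =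
      metric d u v • ψ - vectorAct d v (vectorAct d u ψ) := by
  have h := vectorAct_vectorAct_self d (u + v) ψ
  rw [map_add, LinearMap.add_apply, LinearMap.add_apply, map_add, map_add,
    vectorAct_vectorAct_self, vectorAct_vectorAct_self] at h
  rw [metric, QuadraticMap.polar, sub_smul, sub_smul, ← h]
  abel

theorem metric_eq_zero_of_mem_ann {d : ℕ} {ψ : Spinor d} (hψ : ψ ≠ 0) {u v : V d}
    (hu : u ∈ ann d ψ) (hv : v ∈ ann d ψ) : metric d u v = 0 := by
  have h := vectorAct_anticomm d u v ψ
  rw [mem_ann.1 hu, mem_ann.1 hv, map_zero, map_zero, sub_zero] at h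
  exact (smul_eq_zero.1 h.symm).resolve_right hψ

theorem spinorRep_ι (d : ℕ) (u : V d) : spinorRep d (ι (Q d) u) = vectorAct d u :=
  CliffordAlgebra.lift_ι_apply _ _ _

/-- The spinors of parity `n`. -/
abbrev parityPart (d : ℕ) (n : ZMod 2) : Submodule ℂ (Spinor d) :=
  evenOdd (0 : QuadraticForm ℂ (Fin d → ℂ)) n

theorem contractLeft_mem_evenOdd {M : Type*} [AddCommGroup M] [Module ℂ M]
    (q : QuadraticForm ℂ M) (f : Module.Dual ℂ M)
    (n : ZMod 2) {x : CliffordAlgebra q} (hx : x ∈ evenOdd q n) :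
    contractLeft f x ∈ evenOdd q (n + 1) := by
  induction x, hx using evenOdd_induction with
  | range_ι_pow x hx =>
    fin_cases n
    · have hx' : x ∈ LinearMap.range (ι q) ^ 0 := hx
      rw [pow_zero] at hx'
      obtain ⟨r, rfl⟩ := Submodule.mem_one.1 hx'
      rw [contractLeft_algebraMap]
      exact Submodule.zero_mem _
    · have hx' : x ∈ LinearMap.range (ι q) ^ 1 := hx
      rw [pow_one] at hx'
      obtain ⟨v, rfl⟩ := hx'
      rw [contractLeft_ι]
      exact one_le_evenOdd_zero q (Submodule.mem_one.2 ⟨_, rfl⟩)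
  | add x y hx hy hx' hy' => rw [map_add]; exact Submodule.add_mem _ hx' hy'
  | ι_mul_ι_mul v w x hx hx' =>
    have hι : ∀ (u : M) (m : ZMod 2) (y : CliffordAlgebra q), y ∈ evenOdd q m →
        ι q u * y ∈ evenOdd q (1 + m) := fun u m y hy =>
      evenOdd_mul_le q 1 m (Submodule.mul_mem_mul (ι_mem_evenOdd_one q u) hy)
    have h2 : (1 : ZMod 2) + (1 + (n + 1)) = n + 1 := by
      rw [← add_assoc, show (1 + 1 : ZMod 2) = 0 from rfl, zero_add]
    rw [mul_assoc, contractLeft_ι_mul, contractLeft_ι_mul, mul_sub, mul_smul_comm]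
    refine Submodule.sub_mem _ (Submodule.smul_mem _ _ ?_) (Submodule.sub_mem _
      (Submodule.smul_mem _ _ ?_) ?_)
    · rw [add_comm]; exact hι w n x hx
    · rw [add_comm]; exact hι v n x hx
    · have := hι v _ _ (hι w _ _ hx')
      rwa [h2] at this

theorem vectorAct_mem_parityPart (d : ℕ) (u : V d) {n : ZMod 2} {ψ : Spinor d}
    (hψ : ψ ∈ parityPart d n) : vectorAct d u ψ ∈ parityPart d (n + 1) := by
  rw [vectorAct_apply]
  refine Submodule.add_mem _ (contractLeft_mem_evenOdd _ _ _ hψ) ?_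
  rw [add_comm]
  exact evenOdd_mul_le _ 1 n (Submodule.mul_mem_mul (ι_mem_evenOdd_one _ _) hψ)

theorem vectorAct_vectorAct_mem_semiSpinor (d : ℕ) (u v : V d) {ψ : Spinor d}
    (hψ : ψ ∈ semiSpinor d) : vectorAct d u (vectorAct d v ψ) ∈ semiSpinor d := by
  have h := vectorAct_mem_parityPart d u (vectorAct_mem_parityPart d v hψ)
  rwa [show (0 + 1 + 1 : ZMod 2) = 0 from rfl] at h

/-! ### Frames: canonical bases with a vacuum -/

/-- A canonical basis `(a, a')` with a nonzero spinor `χ` killed by all `a_i`. -/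
structure IsFrame (d : ℕ) (a a' : Fin d → V d) (χ : Spinor d) : Prop where
  basis : IsCanonicalBasis d a a'
  ne_zero : χ ≠ 0
  kills : ∀ i, vectorAct d (a i) χ = 0

namespace IsFrame

variable {d : ℕ} {a a' : Fin d → V d} {χ : Spinor d} (h : IsFrame d a a' χ)
include h

theorem mem_ann_iff {u : V d} : u ∈ ann d χ ↔ ∀ i, metric d u (a i) = 0 := by
  constructor
  · exact fun hu i => metric_eq_zero_of_mem_ann h.ne_zero hu (h.kills i)
  · intro hu
    have hs : Submodule.span ℂ (Set.range a) ≤ ann d χ := by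
      rw [Submodule.span_le]
      rintro _ ⟨i, rfl⟩
      exact h.kills i
    exact hs (h.basis.mem_span_iff.2 hu)

theorem ann_eq : ann d χ = Submodule.span ℂ (Set.range a) := by
  ext u
  rw [h.mem_ann_iff, h.basis.mem_span_iff]

theorem isPure : IsPure d χ :=
  ⟨h.ne_zero, by rw [h.ann_eq, h.basis.finrank_span]⟩

end IsFrame

/-! ### Transitivity of the pin group on canonical bases -/

theorem exists_sq_eq (z : ℂ) : ∃ c : ℂ, c ^ 2 = z :=
  IsAlgClosed.exists_pow_nat_eq z two_pos

theorem ι_mem_pinGroup {d : ℕ} {u : V d} (hu : Q d u = -1) : ι (Q d) u ∈ pinGroup (Q d) := by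
  have hsq : ι (Q d) u * ι (Q d) u = -1 := by
    rw [ι_sq_scalar, hu, map_neg, map_one]
  refine pinGroup.mem_iff.2 ⟨?_, ?_⟩
  · refine Submonoid.mem_map.2 ⟨⟨ι (Q d) u, -ι (Q d) u, ?_, ?_⟩, ?_, rfl⟩
    · rw [mul_neg, hsq, neg_neg]
    · rw [neg_mul, hsq, neg_neg]
    · exact Subgroup.subset_closure ⟨u, rfl⟩
  · rw [Unitary.mem_iff, star_ι, mul_neg, neg_mul, hsq, neg_neg]
    exact ⟨rfl, rfl⟩

theorem mul_mem_evenOdd {M : Type*} [AddCommGroup M] [Module ℂ M] {q : QuadraticForm ℂ M}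
    {i j k : ZMod 2} (hk : i + j = k) {x y : CliffordAlgebra q} (hx : x ∈ evenOdd q i)
    (hy : y ∈ evenOdd q j) : x * y ∈ evenOdd q k := by
  subst hk
  exact evenOdd_mul_le _ _ _ (Submodule.mul_mem_mul hx hy)

/-- The element `g` of the pin group conjugates the vectors `w j` to `± e j`, the sign being the
parity of `g`. -/
def Intertwines (d : ℕ) {n : Type*} (g : CliffordAlgebra (Q d)) (w e : n → V d) : Prop :=
  g ∈ pinGroup (Q d) ∧
    ((g ∈ evenOdd (Q d) 0 ∧ ∀ j, g * ι (Q d) (w j) = ι (Q d) (e j) * g) ∨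
      (g ∈ evenOdd (Q d) 1 ∧ ∀ j, g * ι (Q d) (w j) = -(ι (Q d) (e j) * g)))

namespace Intertwines

variable {d : ℕ} {n : Type*}

theorem refl (w : n → V d) : Intertwines d 1 w w :=
  ⟨Submonoid.one_mem _, Or.inl ⟨one_le_evenOdd_zero _ (Submodule.mem_one.2 ⟨1, map_one _⟩),
    fun j => by rw [one_mul, mul_one]⟩⟩

theorem trans {g g' : CliffordAlgebra (Q d)} {w e f : n → V d} (h : Intertwines d g w e)
    (h' : Intertwines d g' e f) : Intertwines d (g' * g) w f := by
  refine ⟨Submonoid.mul_mem _ h'.1 h.1, ?_⟩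
  rcases h.2 with ⟨hg, h⟩ | ⟨hg, h⟩ <;> rcases h'.2 with ⟨hg', h'⟩ | ⟨hg', h'⟩
  · exact Or.inl ⟨mul_mem_evenOdd (add_zero 0) hg' hg, fun j => by
      rw [mul_assoc, h, ← mul_assoc, h', mul_assoc]⟩
  · exact Or.inr ⟨mul_mem_evenOdd (add_zero 1) hg' hg, fun j => by
      rw [mul_assoc, h, ← mul_assoc, h', neg_mul, mul_assoc]⟩
  · exact Or.inr ⟨mul_mem_evenOdd (zero_add 1) hg' hg, fun j => by
      rw [mul_assoc, h, mul_neg, ← mul_assoc, h', mul_assoc]⟩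
  · exact Or.inl ⟨mul_mem_evenOdd (by decide) hg' hg, fun j => by
      rw [mul_assoc, h, mul_neg, ← mul_assoc, h', neg_mul, neg_neg, mul_assoc]⟩

/-- Conjugation by a non-null vector is minus a reflection. -/
theorem exists_reflection {r : V d} (hr : Q d r ≠ 0) (w : n → V d) :
    ∃ g, Intertwines d g w fun j => w j - (metric d r (w j) / Q d r) • r := by
  obtain ⟨c, hc⟩ := exists_sq_eq (-(Q d r)⁻¹)
  have hu : Q d (c • r) = -1 := by
    rw [QuadraticMap.map_smul, smul_eq_mul, ← pow_two, hc, neg_mul, inv_mul_cancel₀ hr]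
  refine ⟨ι (Q d) (c • r), ι_mem_pinGroup hu, Or.inr ⟨ι_mem_evenOdd_one _ _, fun j => ?_⟩⟩
  have h1 := ι_mul_ι_add_swap (Q := Q d) r (w j)
  have h2 := ι_sq_scalar (Q d) r
  rw [Algebra.algebraMap_eq_smul_one] at h1 h2
  rw [eq_neg_iff_add_eq_zero, map_sub, map_smul, map_smul, sub_mul, smul_mul_assoc,
    mul_smul_comm, mul_smul_comm, smul_mul_assoc, h2, ← add_sub_assoc, ← smul_add, h1, smul_smul,
    smul_smul, smul_smul, ← sub_smul]
  rw [show c * QuadraticMap.polar (Q d) r (w j) -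
    c * (metric d r (w j) / Q d r) * Q d r = 0 by
      rw [mul_assoc, div_mul_cancel₀ _ hr, sub_self], zero_smul]

theorem map_linear {m : Type*} [Fintype n] {g : CliffordAlgebra (Q d)} {w e : n → V d}
    (h : Intertwines d g w e) (c : m → n → ℂ) :
    Intertwines d g (fun k => ∑ j, c k j • w j) fun k => ∑ j, c k j • e j := by
  refine ⟨h.1, h.2.imp (fun h => ⟨h.1, fun k => ?_⟩) fun h => ⟨h.1, fun k => ?_⟩⟩
  · simp_rw [map_sum, map_smul, Finset.mul_sum, Finset.sum_mul, mul_smul_comm, smul_mul_assoc, h.2]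
  · simp_rw [map_sum, map_smul, Finset.mul_sum, Finset.sum_mul, mul_smul_comm, smul_mul_assoc, h.2,
      smul_neg, Finset.sum_neg_distrib]

end Intertwines

/-- A family of mutually orthogonal vectors with `Q = 1`. -/
def IsOrthonormal (d : ℕ) {n : Type*} [DecidableEq n] (w : n → V d) : Prop :=
  ∀ i j, metric d (w i) (w j) = if i = j then 2 else 0

theorem IsOrthonormal.reflect {d : ℕ} {n : Type*} [DecidableEq n] {w : n → V d}
    (hw : IsOrthonormal d w) {r : V d} (hr : Q d r ≠ 0) :
    IsOrthonormal d fun j => w j - (metric d r (w j) / Q d r) • r := by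
  intro i j
  rw [← hw i j]
  simp only [metric_sub_left, metric_sub_right, metric_smul_left, metric_smul_right, metric_self,
    metric_comm d _ r]
  field_simp
  ring

theorem IsOrthonormal.Q_eq {d : ℕ} {n : Type*} [DecidableEq n] {w : n → V d}
    (hw : IsOrthonormal d w) (i : n) : Q d (w i) = 1 := by
  have h := hw i i
  rw [metric_self, if_pos rfl] at h
  exact mul_left_cancel₀ two_ne_zero (h.trans (mul_one 2).symm)

/-- One step of the Cartan–Dieudonné argument: `w k` is moved to `e k` by at most two reflections,
in `w k - e k`, or in `w k + e k` and `e k`, fixing the vectors that `w` and `e` share. -/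
theorem IsOrthonormal.exists_step {d : ℕ} {n : Type*} [DecidableEq n] {w e : n → V d}
    (hw : IsOrthonormal d w) (he : IsOrthonormal d e) (s : Set n) {k : n} (hk : k ∉ s)
    (hs : ∀ j ∈ s, w j = e j) :
    ∃ g w', Intertwines d g w w' ∧ IsOrthonormal d w' ∧ w' k = e k ∧ ∀ j ∈ s, w' j = e j := by
  have hQw := hw.Q_eq k
  have hQe := he.Q_eq k
  have hww := hw k k
  have hee := he k k
  rw [if_pos rfl] at hww hee
  have hQ : ∀ u v : V d, Q d (u + v) = Q d u + Q d v + metric d u v := fun u v =>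
    (QuadraticMap.map_add (Q d) u v)
  have hsub : Q d (w k - e k) = 2 - metric d (w k) (e k) := by
    rw [sub_eq_add_neg, hQ, QuadraticMap.map_neg, hQw, hQe, metric, QuadraticMap.polar_neg_right]
    ring
  have hadd : Q d (w k + e k) = 2 + metric d (w k) (e k) := by
    rw [hQ, hQw, hQe]; ring
  have hwk : ∀ j ∈ s, metric d (w k) (e j) = 0 := fun j hj => by
    rw [← hs j hj, hw, if_neg]; rintro rfl; exact hk hj
  have hek : ∀ j ∈ s, metric d (e k) (e j) = 0 := fun j hj => by
    rw [he, if_neg]; rintro rfl; exact hk hj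
  by_cases h : Q d (w k - e k) = 0
  · have h2 : metric d (w k) (e k) = 2 := by
      rw [hsub, sub_eq_zero] at h; exact h.symm
    have hr : Q d (w k + e k) ≠ 0 := by rw [hadd, h2]; norm_num
    have hr' : Q d (e k) ≠ 0 := by rw [hQe]; exact one_ne_zero
    obtain ⟨g, hg⟩ := Intertwines.exists_reflection hr w
    obtain ⟨g', hg'⟩ := Intertwines.exists_reflection hr'
      (fun j => w j - (metric d (w k + e k) (w j) / Q d (w k + e k)) • (w k + e k))
    refine ⟨_, _, hg.trans hg', (hw.reflect hr).reflect hr', ?_, fun j hj => ?_⟩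
    · have h3 : metric d (w k + e k) (w k) / Q d (w k + e k) = 1 := by
        rw [metric_add_left, hww, metric_comm, h2, hadd, h2]; norm_num
      simp only [h3, one_smul]
      rw [hQe, metric_sub_right, metric_add_right, hee, metric_comm, h2]
      rw [show ((2 : ℂ) - (2 + 2)) / 1 = -2 by norm_num]
      module
    · have h3 : metric d (w k + e k) (w j) = 0 := by
        rw [metric_add_left, hs j hj, hwk j hj, hek j hj, add_zero]
      have h4 : metric d (e k) (w j) = 0 := by rw [hs j hj, hek j hj]
      simp only [h3, h4, zero_div, zero_smul, sub_zero]
      exact hs j hj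
  · obtain ⟨g, hg⟩ := Intertwines.exists_reflection h w
    refine ⟨g, _, hg, hw.reflect h, ?_, fun j hj => ?_⟩
    · have h3 : metric d (w k - e k) (w k) / Q d (w k - e k) = 1 := by
        rw [metric_sub_left, hww, metric_comm, ← hsub, div_self h]
      simp only [h3, one_smul, sub_sub_cancel]
    · have h3 : metric d (w k - e k) (w j) = 0 := by
        rw [metric_sub_left, hs j hj, hwk j hj, hek j hj, sub_zero]
      simp only [h3, zero_div, zero_smul, sub_zero]
      exact hs j hj

theorem IsOrthonormal.exists_intertwines {d : ℕ} {n : Type*} [DecidableEq n] [Fintype n]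
    {w e : n → V d} (hw : IsOrthonormal d w) (he : IsOrthonormal d e) :
    ∃ g, Intertwines d g w e := by
  suffices h : ∀ (t : Finset n) (w : n → V d), IsOrthonormal d w → (∀ j ∉ t, w j = e j) →
      ∃ g, Intertwines d g w e from h Finset.univ w hw fun j hj => absurd (Finset.mem_univ j) hj
  intro t
  induction t using Finset.induction_on with
  | empty =>
    intro w _ h
    rw [funext fun j => h j (Finset.notMem_empty j)]
    exact ⟨1, Intertwines.refl e⟩
  | insert k t _ ih =>
    intro w hw h
    obtain ⟨g, w', hg, hw', hk, hs⟩ := hw.exists_step he {j | j ∉ insert k t} (k := k)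
      (fun hk => hk (Finset.mem_insert_self k t)) h
    obtain ⟨g', hg'⟩ := ih w' hw' fun j hj => by
      by_cases hjk : j = k
      · rw [hjk, hk]
      · exact hs j fun hj' => (Finset.mem_insert.1 hj').elim hjk hj
    exact ⟨_, hg.trans hg'⟩

/-- The orthonormal family `a_i + a'_i`, `√-1 (a_i - a'_i)` of a canonical basis. -/
def orthFamily {d : ℕ} (a a' : Fin d → V d) : Fin d ⊕ Fin d → V d :=
  Sum.elim (fun i => a i + a' i) fun i => Complex.I • (a i - a' i)

theorem IsCanonicalBasis.isOrthonormal {d : ℕ} {a a' : Fin d → V d}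
    (h : IsCanonicalBasis d a a') : IsOrthonormal d (orthFamily a a') := by
  rintro (i | i) (j | j) <;>
    simp only [orthFamily, Sum.elim_inl, Sum.elim_inr, metric_add_left, metric_add_right,
      metric_smul_left, metric_smul_right, metric_sub_left, metric_sub_right, h.null, h.null',
      h.pairing, h.pairing', Sum.inl.injEq, Sum.inr.injEq, reduceCtorEq, if_false]
  · split_ifs <;> norm_num
  · ring
  · ring
  · rw [← mul_sub, ← mul_assoc, Complex.I_mul_I]
    split_ifs <;> norm_num

/-- The pin group is transitive on canonical bases, up to the sign in `Intertwines`. -/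
theorem IsCanonicalBasis.exists_intertwines {d : ℕ} {a a' c c' : Fin d → V d}
    (h : IsCanonicalBasis d a a') (h' : IsCanonicalBasis d c c') :
    ∃ g, Intertwines d g (Sum.elim a a') (Sum.elim c c') := by
  obtain ⟨g, hg⟩ := h.isOrthonormal.exists_intertwines h'.isOrthonormal
  let m : Fin d ⊕ Fin d → Fin d ⊕ Fin d → ℂ := Sum.elim
    (fun i => Sum.elim (Pi.single i (1 / 2)) (Pi.single i (-Complex.I / 2)))
    (fun i => Sum.elim (Pi.single i (1 / 2)) (Pi.single i (Complex.I / 2)))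
  have hm : ∀ b b' : Fin d → V d,
      (fun k => ∑ j, m k j • orthFamily b b' j) = Sum.elim b b' := by
    intro b b'
    have hI : Complex.I * Complex.I = -1 := Complex.I_mul_I
    funext k
    rcases k with i | i <;>
      simp only [m, Fintype.sum_sum_type, orthFamily, Sum.elim_inl, Sum.elim_inr,
        Pi.single_apply, ite_smul, zero_smul, Finset.sum_ite_eq', Finset.mem_univ, if_true] <;>
      rw [smul_smul]
    · rw [show -Complex.I / 2 * Complex.I = 1 / 2 by linear_combination (-1 / 2 : ℂ) * hI]
      module
    · rw [show Complex.I / 2 * Complex.I = -(1 / 2) by linear_combination (1 / 2 : ℂ) * hI]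
      module
  have := hg.map_linear m
  rw [hm, hm] at this
  exact ⟨g, this⟩

/-! ### The spinor representation and uniqueness of the vacuum -/

theorem spinorRep_mem_parityPart {d : ℕ} {i j k : ZMod 2} (hk : i + j = k)
    {g : CliffordAlgebra (Q d)} (hg : g ∈ evenOdd (Q d) i)
    {ψ : Spinor d} (hψ : ψ ∈ parityPart d j) : spinorRep d g ψ ∈ parityPart d k := by
  subst hk
  induction g, hg using evenOdd_induction with
  | range_ι_pow x hx =>
    obtain rfl | rfl : i = 0 ∨ i = 1 := by
      have h01 : ∀ i : ZMod 2, i = 0 ∨ i = 1 := by decide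
      exact h01 i
    · have hx' : x ∈ LinearMap.range (ι (Q d)) ^ 0 := hx
      rw [pow_zero] at hx'
      obtain ⟨r, rfl⟩ := Submodule.mem_one.1 hx'
      rw [AlgHom.commutes, Module.algebraMap_end_apply, zero_add]
      exact Submodule.smul_mem _ _ hψ
    · have hx' : x ∈ LinearMap.range (ι (Q d)) ^ 1 := hx
      rw [pow_one] at hx'
      obtain ⟨v, rfl⟩ := hx'
      rw [spinorRep_ι, add_comm]
      exact vectorAct_mem_parityPart d v hψ
  | add x y _ _ hx hy =>
    rw [map_add, LinearMap.add_apply]; exact Submodule.add_mem _ hx hy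
  | ι_mul_ι_mul v w x _ hx =>
    have h := vectorAct_mem_parityPart d v (vectorAct_mem_parityPart d w hx)
    rw [add_assoc (i + j), show (1 + 1 : ZMod 2) = 0 from rfl, add_zero] at h
    rw [map_mul, map_mul, spinorRep_ι, spinorRep_ι]
    exact h

theorem spinorRep_injective_of_mem_pinGroup {d : ℕ} {g : CliffordAlgebra (Q d)}
    (hg : g ∈ pinGroup (Q d)) : Function.Injective (spinorRep d g) := by
  refine Function.LeftInverse.injective (g := spinorRep d (star g)) fun ψ => ?_
  rw [← Module.End.mul_apply, ← map_mul, pinGroup.star_mul_self_of_mem hg, map_one,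
    Module.End.one_apply]

theorem Intertwines.vectorAct_eq_zero {d : ℕ} {n : Type*} {g : CliffordAlgebra (Q d)}
    {w e : n → V d} (h : Intertwines d g w e) {j : n} {ψ : Spinor d}
    (hψ : vectorAct d (w j) ψ = 0) : vectorAct d (e j) (spinorRep d g ψ) = 0 := by
  have key : spinorRep d (g * ι (Q d) (w j)) ψ = 0 := by
    rw [map_mul, spinorRep_ι, Module.End.mul_apply, hψ, map_zero]
  rcases h.2 with ⟨-, h⟩ | ⟨-, h⟩
  · rw [h, map_mul, spinorRep_ι] at key
    exact key
  · rw [h, map_neg, map_mul, spinorRep_ι, LinearMap.neg_apply, neg_eq_zero] at key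
    exact key

theorem eq_algebraMap_of_stdA {d : ℕ} {ψ : Spinor d}
    (h : ∀ i, vectorAct d (stdA d i) ψ = 0) : ∃ r : ℂ, ψ = algebraMap ℂ _ r := by
  refine mem_range_algebraMap_of_contractLeft_eq_zero (Pi.basisFun ℂ (Fin d)) fun i => ?_
  have hi := h i
  rw [vectorAct_apply] at hi
  have hc : (Pi.basisFun ℂ (Fin d)).coord i = LinearMap.proj i := by
    refine LinearMap.ext fun x => ?_
    simp
  rw [hc]
  simpa [stdA] using hi

/-- The vacuum of a canonical basis is unique up to scale. -/
theorem IsFrame.exists_smul {d : ℕ} {a a' : Fin d → V d} {χ χ' : Spinor d}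
    (h : IsFrame d a a' χ) (hχ' : ∀ i, vectorAct d (a i) χ' = 0) : ∃ r : ℂ, χ' = r • χ := by
  obtain ⟨g, hg⟩ := h.basis.exists_intertwines (isCanonicalBasis_std d)
  obtain ⟨r, hr⟩ := eq_algebraMap_of_stdA (ψ := spinorRep d g χ) fun i =>
    hg.vectorAct_eq_zero (j := Sum.inl i) (h.kills i)
  obtain ⟨r', hr'⟩ := eq_algebraMap_of_stdA (ψ := spinorRep d g χ') fun i =>
    hg.vectorAct_eq_zero (j := Sum.inl i) (hχ' i)
  have hinj := spinorRep_injective_of_mem_pinGroup hg.1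
  have hr0 : r ≠ 0 := by
    rintro rfl
    rw [map_zero] at hr
    exact h.ne_zero (hinj (hr.trans (map_zero _).symm))
  refine ⟨r' / r, hinj ?_⟩
  rw [hr', map_smul, hr, Algebra.algebraMap_eq_smul_one, Algebra.algebraMap_eq_smul_one, smul_smul,
    div_mul_cancel₀ _ hr0]

/-! ### Exchanging creation and annihilation operators -/

open scoped symmDiff

/-- The family `a` with `a_i` replaced by `a'_i` for `i ∈ J`. -/
def swapFamily {d : ℕ} (a a' : Fin d → V d) (J : Finset (Fin d)) (i : Fin d) : V d :=
  if i ∈ J then a' i else a i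

theorem swapFamily_swapFamily {d : ℕ} (a a' : Fin d → V d) (I J : Finset (Fin d)) :
    swapFamily (swapFamily a a' I) (swapFamily a' a I) J = swapFamily a a' (I ∆ J) := by
  funext i
  by_cases hi : i ∈ I <;> by_cases hj : i ∈ J <;> simp [swapFamily, Finset.mem_symmDiff, hi, hj]

theorem IsCanonicalBasis.swap {d : ℕ} {a a' : Fin d → V d} (h : IsCanonicalBasis d a a')
    (J : Finset (Fin d)) : IsCanonicalBasis d (swapFamily a a' J) (swapFamily a' a J) := by
  refine ⟨fun i j => ?_, fun i j => ?_, fun i j => ?_⟩ <;>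
    by_cases hi : i ∈ J <;> by_cases hj : j ∈ J <;>
    simp only [swapFamily, hi, hj, if_true, if_false, h.null, h.null', h.pairing, h.pairing'] <;>
    rw [if_neg] <;> rintro rfl <;> contradiction

theorem IsCanonicalBasis.Q_right {d : ℕ} {a a' : Fin d → V d} (h : IsCanonicalBasis d a a')
    (i : Fin d) : Q d (a' i) = 0 := by
  have := h.null' i i
  rw [metric_self] at this
  exact (mul_eq_zero.1 this).resolve_left two_ne_zero

/-- The product of the creation operators listed in `l`, applied to a spinor. -/
def listSpinor (d : ℕ) (a' : Fin d → V d) (χ : Spinor d) (l : List (Fin d)) : Spinor d :=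
  l.foldr (fun i ψ => vectorAct d (a' i) ψ) χ

theorem IsFrame.listSpinor {d : ℕ} {a a' : Fin d → V d} {χ : Spinor d} (h : IsFrame d a a' χ)
    {l : List (Fin d)} (hl : l.Nodup) :
    IsFrame d (swapFamily a a' l.toFinset) (swapFamily a' a l.toFinset) (listSpinor d a' χ l) := by
  induction l with
  | nil =>
    refine ⟨h.basis.swap _, h.ne_zero, fun i => ?_⟩
    have : swapFamily a a' [].toFinset i = a i := by simp [swapFamily]
    rw [this]
    exact h.kills i
  | cons j l ih =>
    obtain ⟨hj, hl'⟩ := List.nodup_cons.1 hl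
    have ih := ih hl'
    have hjs : a j = swapFamily a a' l.toFinset j := by simp [swapFamily, hj]
    have hk : vectorAct d (a j) (SpinorOrbits.listSpinor d a' χ l) = 0 := by
      rw [hjs]; exact ih.kills j
    refine ⟨h.basis.swap _, fun h0 => ih.ne_zero ?_, fun i => ?_⟩
    · have h1 : vectorAct d (a j) (vectorAct d (a' j) (SpinorOrbits.listSpinor d a' χ l)) = 0 := by
        rw [show vectorAct d (a' j) (SpinorOrbits.listSpinor d a' χ l) = 0 from h0, map_zero]
      rwa [vectorAct_anticomm, hk, map_zero, sub_zero, h.basis.pairing, if_pos rfl, one_smul] at h1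
    · change vectorAct d _ (vectorAct d (a' j) (SpinorOrbits.listSpinor d a' χ l)) = 0
      by_cases hij : i = j
      · subst hij
        have : swapFamily a a' (i :: l).toFinset i = a' i := by simp [swapFamily]
        rw [this, vectorAct_vectorAct_self, h.basis.Q_right, zero_smul]
      · have h1 : swapFamily a a' (j :: l).toFinset i = swapFamily a a' l.toFinset i := by
          simp [swapFamily, hij]
        have h2 : metric d (swapFamily a a' l.toFinset i) (a' j) = 0 := by
          by_cases hi : i ∈ l
          · simp only [swapFamily, List.mem_toFinset, hi, if_true, h.basis.null']
          · simp only [swapFamily, List.mem_toFinset, hi, if_false, h.basis.pairing, hij]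
        rw [h1, vectorAct_anticomm, ih.kills i, map_zero, sub_zero, h2, zero_smul]

theorem listSpinor_mem_parityPart {d : ℕ} (a' : Fin d → V d) {χ : Spinor d} {n : ZMod 2}
    (hχ : χ ∈ parityPart d n) (l : List (Fin d)) :
    listSpinor d a' χ l ∈ parityPart d (n + l.length) := by
  induction l with
  | nil => simpa [listSpinor] using hχ
  | cons j l ih =>
    have := vectorAct_mem_parityPart d (a' j) ih
    rw [add_assoc] at this
    rw [List.length_cons, Nat.cast_succ]
    exact this

/-- The members of a configuration are the vacua obtained from the first frame by exchanging
creation and annihilation operators; any member `ψ α₀` may serve as the vacuum that is exchanged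
for nothing. -/
theorem IsConfiguration.exists_frames {d k : ℕ} {ψ : Fin k → Spinor d} (h : IsConfiguration d ψ)
    (α₀ : Fin k) : ∃ (b b' : Fin d → V d) (J : Fin k → Finset (Fin d)), J α₀ = ∅ ∧
      ∀ α, ψ α ∈ semiSpinor d ∧
        IsFrame d (swapFamily b b' (J α)) (swapFamily b' b (J α)) (ψ α) := by
  obtain ⟨⟨a, a', ψ₀, hb, hS, h0, hk, I, hI⟩, -⟩ := h
  have hf : IsFrame d a a' ψ₀ := ⟨hb, h0, hk⟩
  refine ⟨swapFamily a a' (I α₀), swapFamily a' a (I α₀), fun α => I α₀ ∆ I α, by simp,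
    fun α => ?_⟩
  obtain ⟨hev, hα⟩ := hI α
  rw [swapFamily_swapFamily, swapFamily_swapFamily, ← symmDiff_assoc, symmDiff_self, bot_symmDiff]
  have hl : ψ α = listSpinor d a' ψ₀ ((I α).sort (· ≤ ·)) := hα
  rw [hl]
  constructor
  · have := listSpinor_mem_parityPart a' (n := 0) hS ((I α).sort (· ≤ ·))
    rwa [Finset.length_sort, (ZMod.natCast_eq_zero_iff_even).2 hev, add_zero] at this
  · have := hf.listSpinor (Finset.sort_nodup (I α) (· ≤ ·))
    rwa [Finset.sort_toFinset] at this

section Dimensions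

variable {d : ℕ} {b b' : Fin d → V d} {I J : Finset (Fin d)} {φ ψ : Spinor d}

theorem le_finrank_inf_add_card
    (hφ : IsFrame d (swapFamily b b' I) (swapFamily b' b I) φ)
    (hψ : IsFrame d (swapFamily b b' J) (swapFamily b' b J) ψ) :
    d ≤ Module.finrank ℂ (ann d φ ⊓ ann d ψ : Submodule ℂ (V d)) + (I ∆ J).card := by
  refine hφ.basis.le_finrank_add_card _ _ fun i hi => ⟨hφ.kills i, ?_⟩
  have : swapFamily b b' I i = swapFamily b b' J i := by
    rw [Finset.mem_symmDiff] at hi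
    by_cases h1 : i ∈ I <;> by_cases h2 : i ∈ J <;> simp_all [swapFamily]
  rw [this]
  exact hψ.kills i

end Dimensions

theorem swapFamily_empty {d : ℕ} (a a' : Fin d → V d) : swapFamily a a' ∅ = a := by
  funext i; simp [swapFamily]

/-! ### Shears: the action of bivectors of creation operators -/

/-- The family `c` with `c_p` and `c_q` replaced by `c_p - x b'_q` and `c_q + x b'_p`. -/
def shearFamily {d : ℕ} (c b' : Fin d → V d) (p q : Fin d) (x : ℂ) (i : Fin d) : V d :=
  if i = p then c p - x • b' q else if i = q then c q + x • b' p else c i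

/-- The spinor `(1 + x b'_p b'_q) χ`, equal to `exp (x b'_p b'_q) χ`. -/
def shearSpinor {d : ℕ} (b' : Fin d → V d) (p q : Fin d) (x : ℂ) (χ : Spinor d) : Spinor d :=
  χ + x • vectorAct d (b' p) (vectorAct d (b' q) χ)

theorem shearSpinor_mem {d : ℕ} (b' : Fin d → V d) (p q : Fin d) (x : ℂ) {χ : Spinor d}
    (hχ : χ ∈ semiSpinor d) : shearSpinor b' p q x χ ∈ semiSpinor d :=
  Submodule.add_mem _ hχ
    (Submodule.smul_mem _ _ (vectorAct_vectorAct_mem_semiSpinor d _ _ hχ))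

theorem IsCanonicalBasis.shear {d : ℕ} {c b' : Fin d → V d} (h : IsCanonicalBasis d c b')
    {p q : Fin d} (hpq : p ≠ q) (x : ℂ) : IsCanonicalBasis d (shearFamily c b' p q x) b' := by
  refine ⟨fun i j => ?_, h.null', fun i j => ?_⟩
  · simp only [shearFamily]
    split_ifs <;> subst_vars <;>
      simp only [metric_sub_left, metric_sub_right, metric_add_left, metric_add_right,
        metric_smul_left, metric_smul_right, h.null, h.null', h.pairing, h.pairing'] <;>
      simp_all [eq_comm]
  · simp only [shearFamily]
    split_ifs <;> subst_vars <;>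
      simp only [metric_sub_left, metric_add_left, metric_smul_left, h.null', h.pairing] <;>
      simp_all

theorem IsCanonicalBasis.vectorAct_right_anticomm {d : ℕ} {c b' : Fin d → V d}
    (h : IsCanonicalBasis d c b') (i j : Fin d) (ψ : Spinor d) :
    vectorAct d (b' i) (vectorAct d (b' j) ψ) = -vectorAct d (b' j) (vectorAct d (b' i) ψ) := by
  rw [vectorAct_anticomm, h.null', zero_smul, zero_sub]

theorem IsCanonicalBasis.vectorAct_right_self {d : ℕ} {c b' : Fin d → V d}
    (h : IsCanonicalBasis d c b') (i : Fin d) (ψ : Spinor d) :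
    vectorAct d (b' i) (vectorAct d (b' i) ψ) = 0 := by
  rw [vectorAct_vectorAct_self, h.Q_right, zero_smul]

theorem IsFrame.shear {d : ℕ} {c b' : Fin d → V d} {χ : Spinor d} (h : IsFrame d c b' χ)
    {p q : Fin d} (hpq : p ≠ q) (x : ℂ) :
    IsFrame d (shearFamily c b' p q x) b' (shearSpinor b' p q x χ) := by
  have hb := h.basis
  -- moving an annihilation operator through the bivector
  have hc : ∀ i, vectorAct d (c i) (vectorAct d (b' p) (vectorAct d (b' q) χ)) =
      (if i = p then (1 : ℂ) else 0) • vectorAct d (b' q) χ -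
        (if i = q then (1 : ℂ) else 0) • vectorAct d (b' p) χ := by
    intro i
    rw [vectorAct_anticomm, hb.pairing, vectorAct_anticomm d (c i), hb.pairing, h.kills, map_zero,
      sub_zero, map_smul]
  refine ⟨hb.shear hpq x, fun h0 => h.ne_zero ?_, fun i => ?_⟩
  · -- the bivector squares to zero, so `1 + x b'_p b'_q` is invertible
    have h1 : χ = -(x • vectorAct d (b' p) (vectorAct d (b' q) χ)) :=
      eq_neg_of_add_eq_zero_left h0
    have h2 : vectorAct d (b' q) χ = 0 := by
      rw [h1, map_neg, map_smul, hb.vectorAct_right_anticomm q p, hb.vectorAct_right_self, map_zero,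
        neg_zero, smul_zero, neg_zero]
    rw [h1, h2, map_zero, smul_zero, neg_zero]
  · simp only [shearFamily, shearSpinor]
    split_ifs with h1 h2
    · rw [map_sub, map_smul, LinearMap.sub_apply, LinearMap.smul_apply, map_add, map_add, map_smul,
        map_smul, hc, h.kills, if_pos rfl, if_neg hpq, hb.vectorAct_right_anticomm q p,
        hb.vectorAct_right_self, map_zero]
      simp
    · rw [map_add (vectorAct d), map_smul (vectorAct d), LinearMap.add_apply,
        LinearMap.smul_apply, map_add, map_add, map_smul,
        map_smul, hc, h.kills, if_pos rfl, if_neg hpq.symm, hb.vectorAct_right_self]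
      simp
    · rw [map_add, map_smul, hc, h.kills, if_neg h1, if_neg h2]
      simp

theorem IsFrame.smul {d : ℕ} {c b' : Fin d → V d} {χ : Spinor d} (h : IsFrame d c b' χ)
    {r : ℂ} (hr : r ≠ 0) : IsFrame d c b' (r • χ) :=
  ⟨h.basis, smul_ne_zero hr h.ne_zero, fun i => by rw [map_smul, h.kills, smul_zero]⟩

/-! ### Merging four pure spinors into two -/

theorem card_symmDiff_add_card_inter {n : Type*} [DecidableEq n] (X Y : Finset n) :
    (X ∆ Y).card + (X ∩ Y).card = (X ∪ Y).card := by
  rw [← Finset.card_union_of_disjoint]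
  · congr 1; ext i; simp only [Finset.mem_union, Finset.mem_symmDiff, Finset.mem_inter]; tauto
  · rw [Finset.disjoint_left]
    intro i; simp only [Finset.mem_symmDiff, Finset.mem_inter]; tauto

/-- Three sets of size at least four, at mutual distance at least four and contained in a set of
size six, are the unions of two out of three disjoint pairs. -/
theorem exists_pairs {n : Type*} [DecidableEq n] {A B C : Finset n} (hA : 4 ≤ A.card)
    (hB : 4 ≤ B.card) (hC : 4 ≤ C.card) (hAB : 4 ≤ (A ∆ B).card) (hAC : 4 ≤ (A ∆ C).card)
    (hBC : 4 ≤ (B ∆ C).card) (hABC : (A ∪ B ∪ C).card ≤ 6) :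
    ∃ x₁ x₂ y₁ y₂ z₁ z₂ : n, [x₁, x₂, y₁, y₂, z₁, z₂].Nodup ∧
      A = [y₁, y₂, z₁, z₂].toFinset ∧ B = [x₁, x₂, z₁, z₂].toFinset ∧
      C = [x₁, x₂, y₁, y₂].toFinset := by
  have taut : ∀ {a b c m : Prop}, (m ↔ a ∨ b) → (m ↔ a ∨ c) → ¬ (a ∧ b ∧ c) →
      (a ↔ (m ∧ ¬ b) ∨ (m ∧ ¬ c)) := by
    intros; tauto
  set D := A ∪ B ∪ C with hD
  have two : ∀ X Y : Finset n, 4 ≤ X.card → 4 ≤ Y.card → 4 ≤ (X ∆ Y).card → X ∪ Y ⊆ D →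
      X ∪ Y = D ∧ X.card = 4 ∧ Y.card = 4 ∧ D.card = 6 := by
    intro X Y hX hY hXY hs
    have h1 := card_symmDiff_add_card_inter X Y
    have h2 := Finset.card_union_add_card_inter X Y
    have h3 := Finset.card_le_card hs
    exact ⟨Finset.eq_of_subset_of_card_le hs (by omega), by omega, by omega, by omega⟩
  have sAB : A ∪ B ⊆ D := Finset.subset_union_left
  have sC : C ⊆ D := Finset.subset_union_right
  have sA : A ⊆ D := Finset.subset_union_left.trans sAB
  have sB : B ⊆ D := Finset.subset_union_right.trans sAB
  obtain ⟨uAB, cA, cB, cD⟩ := two A B hA hB hAB sAB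
  obtain ⟨uAC, -, cC, -⟩ := two A C hA hC hAC (Finset.union_subset sA sC)
  obtain ⟨uBC, -, -, -⟩ := two B C hB hC hBC (Finset.union_subset sB sC)
  have sub : ∀ X ⊆ D, X.card = 4 → ∃ x y, x ≠ y ∧ D \ X = {x, y} := fun X hX hc =>
    Finset.card_eq_two.1 (by rw [Finset.card_sdiff_of_subset hX]; omega)
  obtain ⟨x₁, x₂, hx, hX⟩ := sub A sA cA
  obtain ⟨y₁, y₂, hy, hY⟩ := sub B sB cB
  obtain ⟨z₁, z₂, hz, hZ⟩ := sub C sC cC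
  have mX : ∀ i, (i = x₁ ∨ i = x₂) ↔ i ∈ D ∧ i ∉ A := fun i => by
    rw [← Finset.mem_sdiff, hX]; simp
  have mY : ∀ i, (i = y₁ ∨ i = y₂) ↔ i ∈ D ∧ i ∉ B := fun i => by
    rw [← Finset.mem_sdiff, hY]; simp
  have mZ : ∀ i, (i = z₁ ∨ i = z₂) ↔ i ∈ D ∧ i ∉ C := fun i => by
    rw [← Finset.mem_sdiff, hZ]; simp
  have dAB : ∀ i, i ∈ D ↔ i ∈ A ∨ i ∈ B := fun i => by rw [← uAB, Finset.mem_union]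
  have dAC : ∀ i, i ∈ D ↔ i ∈ A ∨ i ∈ C := fun i => by rw [← uAC, Finset.mem_union]
  have dBC : ∀ i, i ∈ D ↔ i ∈ B ∨ i ∈ C := fun i => by rw [← uBC, Finset.mem_union]
  -- no index lies in all three sets
  have dABC : ∀ i, ¬ (i ∈ A ∧ i ∈ B ∧ i ∈ C) := by
    have h3 : (D \ A ∪ D \ B ∪ D \ C).card = 6 := by
      rw [Finset.card_union_of_disjoint, Finset.card_union_of_disjoint, hX, hY, hZ,
        Finset.card_pair hx, Finset.card_pair hy, Finset.card_pair hz]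
      · rw [Finset.disjoint_left]; intro i; simp only [Finset.mem_sdiff]
        have := dAB i; tauto
      · rw [Finset.disjoint_left]; intro i; simp only [Finset.mem_union, Finset.mem_sdiff]
        have := dAC i; have := dBC i; tauto
    have h4 : D \ A ∪ D \ B ∪ D \ C = D :=
      Finset.eq_of_subset_of_card_le (by intro i; simp; tauto) (by omega)
    rintro i ⟨h1, h2, h3⟩
    have : i ∈ D := (dAB i).2 (Or.inl h1)
    rw [← h4] at this
    simp only [Finset.mem_union, Finset.mem_sdiff] at this
    tauto
  refine ⟨x₁, x₂, y₁, y₂, z₁, z₂, ?_, ?_, ?_, ?_⟩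
  · have a1 := (mX x₁).1 (Or.inl rfl)
    have a2 := (mX x₂).1 (Or.inr rfl)
    have b1 := (mY y₁).1 (Or.inl rfl)
    have b2 := (mY y₂).1 (Or.inr rfl)
    have c1 := (mZ z₁).1 (Or.inl rfl)
    have c2 := (mZ z₂).1 (Or.inr rfl)
    have nXY : ∀ i j, (i ∈ D ∧ i ∉ A) → (j ∈ D ∧ j ∉ B) → i ≠ j := by
      rintro i j h1 h2 rfl; have := dAB i; tauto
    have nXZ : ∀ i j, (i ∈ D ∧ i ∉ A) → (j ∈ D ∧ j ∉ C) → i ≠ j := by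
      rintro i j h1 h2 rfl; have := dAC i; tauto
    have nYZ : ∀ i j, (i ∈ D ∧ i ∉ B) → (j ∈ D ∧ j ∉ C) → i ≠ j := by
      rintro i j h1 h2 rfl; have := dBC i; tauto
    simp only [List.nodup_cons, List.mem_cons, List.not_mem_nil, or_false, not_or,
      List.nodup_nil, not_false_iff, and_true]
    exact ⟨⟨hx, nXY _ _ a1 b1, nXY _ _ a1 b2, nXZ _ _ a1 c1, nXZ _ _ a1 c2⟩,
      ⟨nXY _ _ a2 b1, nXY _ _ a2 b2, nXZ _ _ a2 c1, nXZ _ _ a2 c2⟩,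
      ⟨hy, nYZ _ _ b1 c1, nYZ _ _ b1 c2⟩, ⟨nYZ _ _ b2 c1, nYZ _ _ b2 c2⟩, hz⟩
  · ext i
    have e : i ∈ [y₁, y₂, z₁, z₂].toFinset ↔ (i ∈ D ∧ i ∉ B) ∨ (i ∈ D ∧ i ∉ C) := by
      rw [← mY, ← mZ, or_assoc]; simp
    exact (taut (dAB i) (dAC i) (dABC i)).trans e.symm
  · ext i
    have e : i ∈ [x₁, x₂, z₁, z₂].toFinset ↔ (i ∈ D ∧ i ∉ A) ∨ (i ∈ D ∧ i ∉ C) := by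
      rw [← mX, ← mZ, or_assoc]; simp
    exact (taut ((dAB i).trans or_comm) (dBC i) fun h => dABC i ⟨h.2.1, h.1, h.2.2⟩).trans e.symm
  · ext i
    have e : i ∈ [x₁, x₂, y₁, y₂].toFinset ↔ (i ∈ D ∧ i ∉ A) ∨ (i ∈ D ∧ i ∉ B) := by
      rw [← mX, ← mY, or_assoc]; simp
    exact (taut ((dAC i).trans or_comm) ((dBC i).trans or_comm)
      fun h => dABC i ⟨h.2.1, h.2.2, h.1⟩).trans e.symm

theorem exists_products_eq {A B C : ℂ} (hA : A ≠ 0) (hB : B ≠ 0) (hC : C ≠ 0) :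
    ∃ x y z : ℂ, x ≠ 0 ∧ y ≠ 0 ∧ z ≠ 0 ∧ y * z = A ∧ x * z = B ∧ x * y = C := by
  obtain ⟨x, hx⟩ := exists_sq_eq (B * C / A)
  have hx0 : x ≠ 0 := by
    rintro rfl
    rw [zero_pow two_ne_zero] at hx
    exact div_ne_zero (mul_ne_zero hB hC) hA hx.symm
  refine ⟨x, C / x, B / x, hx0, div_ne_zero hC hx0, div_ne_zero hB hx0, ?_, ?_, ?_⟩
  · rw [div_mul_div_comm, ← pow_two, hx]; field_simp
  · field_simp
  · field_simp

/-- The vacuum sheared in three pairs of directions. -/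
def tripleShear {d : ℕ} (b' : Fin d → V d) (x₁ x₂ y₁ y₂ z₁ z₂ : Fin d) (x y z : ℂ)
    (χ : Spinor d) : Spinor d :=
  shearSpinor b' x₁ x₂ x (shearSpinor b' y₁ y₂ y (shearSpinor b' z₁ z₂ z χ))

/-- Twice the even part of `∏ (1 + x_m P_m)` in the three bivectors. -/
theorem tripleShear_add_tripleShear_neg {d : ℕ} (b' : Fin d → V d) (x₁ x₂ y₁ y₂ z₁ z₂ : Fin d)
    (x y z : ℂ) (χ : Spinor d) :
    tripleShear b' x₁ x₂ y₁ y₂ z₁ z₂ x y z χ +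
      tripleShear b' x₁ x₂ y₁ y₂ z₁ z₂ (-x) (-y) (-z) χ =
    (2 : ℂ) • (χ + (y * z) • listSpinor d b' χ [y₁, y₂, z₁, z₂] +
      (x * z) • listSpinor d b' χ [x₁, x₂, z₁, z₂] +
      (x * y) • listSpinor d b' χ [x₁, x₂, y₁, y₂]) := by
  simp only [tripleShear, shearSpinor, listSpinor, List.foldr_cons, List.foldr_nil, map_add,
    map_smul]
  module

/-- The basis of annihilation operators of `tripleShear`. -/
def tripleShearFamily {d : ℕ} (b b' : Fin d → V d) (x₁ x₂ y₁ y₂ z₁ z₂ : Fin d) (x y z : ℂ) :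
    Fin d → V d :=
  shearFamily (shearFamily (shearFamily b b' z₁ z₂ z) b' y₁ y₂ y) b' x₁ x₂ x

/-- The vacua sheared by `ω` and by `-ω` are killed by annihilation operators whose differences span
the creation operators in the six directions; their common annihilator is orthogonal to these. -/
theorem tripleShearFamily_sub {d : ℕ} (b b' : Fin d → V d) {x₁ x₂ y₁ y₂ z₁ z₂ : Fin d}
    (hn : [x₁, x₂, y₁, y₂, z₁, z₂].Nodup) {x y z : ℂ} (hx : x ≠ 0) (hy : y ≠ 0) (hz : z ≠ 0)
    {i : Fin d} (hi : i ∈ [x₁, x₂, y₁, y₂, z₁, z₂]) : ∃ r : ℂ, r ≠ 0 ∧ ∃ j,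
      tripleShearFamily b b' x₁ x₂ y₁ y₂ z₁ z₂ x y z j -
        tripleShearFamily b b' x₁ x₂ y₁ y₂ z₁ z₂ (-x) (-y) (-z) j = r • b' i := by
  simp only [List.nodup_cons, List.mem_cons, List.not_mem_nil, or_false, not_or] at hn
  obtain ⟨⟨h1, h2, h3, h4, h5⟩, ⟨h6, h7, h8, h9⟩, ⟨h10, h11, h12⟩, ⟨h13, h14⟩, h15, -⟩ := hn
  have n2 : (2 : ℂ) ≠ 0 := two_ne_zero
  have n2' : (-2 : ℂ) ≠ 0 := neg_ne_zero.2 two_ne_zero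
  simp only [List.mem_cons, List.not_mem_nil, or_false] at hi
  simp only [tripleShearFamily, shearFamily]
  rcases hi with rfl | rfl | rfl | rfl | rfl | rfl
  · refine ⟨2 * x, mul_ne_zero n2 hx, x₂, ?_⟩
    simp only [Ne.symm h1, h6, h7, h8, h9, if_true, if_false]; module
  · refine ⟨-2 * x, mul_ne_zero n2' hx, x₁, ?_⟩
    simp only [h1, h2, h3, h4, h5, if_true, if_false]; module
  · refine ⟨2 * y, mul_ne_zero n2 hy, y₂, ?_⟩
    simp only [Ne.symm h3, Ne.symm h7, Ne.symm h10, h13, h14, if_true, if_false]; module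
  · refine ⟨-2 * y, mul_ne_zero n2' hy, y₁, ?_⟩
    simp only [Ne.symm h2, Ne.symm h6, h10, h11, h12, if_true, if_false]; module
  · refine ⟨2 * z, mul_ne_zero n2 hz, z₂, ?_⟩
    simp only [Ne.symm h5, Ne.symm h9, Ne.symm h12, Ne.symm h14, Ne.symm h15, if_true, if_false]
    module
  · refine ⟨-2 * z, mul_ne_zero n2' hz, z₁, ?_⟩
    simp only [Ne.symm h4, Ne.symm h8, Ne.symm h11, Ne.symm h13, h15, if_true, if_false]
    module

/-- Four pure spinors `χ`, `P₂P₃ χ`, `P₁P₃ χ`, `P₁P₂ χ`, where the `P_m` are bivectors of creation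
operators in three disjoint pairs of directions, add up to two pure spinors
`∏ (1 ± x_m P_m) χ = exp (± ∑ x_m P_m) χ`: the even part of an exponential. -/
theorem exists_two_summands {d : ℕ} {b b' : Fin d → V d} {A B C : Finset (Fin d)}
    {χ ψA ψB ψC : Spinor d} (hχ : IsFrame d b b' χ) (hS : χ ∈ semiSpinor d)
    (fA : IsFrame d (swapFamily b b' A) (swapFamily b' b A) ψA)
    (fB : IsFrame d (swapFamily b b' B) (swapFamily b' b B) ψB)
    (fC : IsFrame d (swapFamily b b' C) (swapFamily b' b C) ψC)
    (hA : 4 ≤ A.card) (hB : 4 ≤ B.card) (hC : 4 ≤ C.card) (hAB : 4 ≤ (A ∆ B).card)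
    (hAC : 4 ≤ (A ∆ C).card) (hBC : 4 ≤ (B ∆ C).card) (hABC : (A ∪ B ∪ C).card ≤ 6)
    {c₀ cA cB cC : ℂ} (h0 : c₀ ≠ 0) (h1 : cA ≠ 0) (h2 : cB ≠ 0) (h3 : cC ≠ 0) :
    ∃ (φ₁ φ₂ : Spinor d) (a₁ a₂ : Fin d → V d), φ₁ ∈ semiSpinor d ∧ φ₂ ∈ semiSpinor d ∧
      IsFrame d a₁ b' φ₁ ∧ IsFrame d a₂ b' φ₂ ∧
      Module.finrank ℂ (ann d φ₁ ⊓ ann d φ₂ : Submodule ℂ (V d)) + 6 ≤ d ∧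
      c₀ • χ + cA • ψA + cB • ψB + cC • ψC = φ₁ + φ₂ := by
  obtain ⟨x₁, x₂, y₁, y₂, z₁, z₂, hn, rfl, rfl, rfl⟩ := exists_pairs hA hB hC hAB hAC hBC hABC
  have hscale : ∀ {l : List (Fin d)} {ψ : Spinor d}, l.Nodup →
      IsFrame d (swapFamily b b' l.toFinset) (swapFamily b' b l.toFinset) ψ →
      ∃ r : ℂ, r ≠ 0 ∧ ψ = r • listSpinor d b' χ l := by
    intro l ψ hl hψ
    obtain ⟨r, hr⟩ := (hχ.listSpinor hl).exists_smul hψ.kills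
    refine ⟨r, ?_, hr⟩
    rintro rfl
    exact hψ.ne_zero (by rw [hr, zero_smul])
  have hn' := hn
  simp only [List.nodup_cons, List.mem_cons, List.not_mem_nil, or_false, not_or] at hn'
  obtain ⟨⟨n1, n2, n3, n4, n5⟩, ⟨n6, n7, n8, n9⟩, ⟨n10, n11, n12⟩, ⟨n13, n14⟩, n15, -⟩ := hn'
  obtain ⟨rA, hrA, eA⟩ := hscale (by simp [*]) fA
  obtain ⟨rB, hrB, eB⟩ := hscale (by simp [*]) fB
  obtain ⟨rC, hrC, eC⟩ := hscale (by simp [*]) fC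
  obtain ⟨x, y, z, hx, hy, hz, hyz, hxz, hxy⟩ := exists_products_eq
    (div_ne_zero (mul_ne_zero h1 hrA) h0) (div_ne_zero (mul_ne_zero h2 hrB) h0)
    (div_ne_zero (mul_ne_zero h3 hrC) h0)
  have hc : c₀ / 2 ≠ 0 := div_ne_zero h0 two_ne_zero
  have hfr : ∀ x y z : ℂ, IsFrame d (tripleShearFamily b b' x₁ x₂ y₁ y₂ z₁ z₂ x y z) b'
      ((c₀ / 2) • tripleShear b' x₁ x₂ y₁ y₂ z₁ z₂ x y z χ) := fun x y z =>
    (((hχ.shear n15 z).shear n10 y).shear n1 x).smul hc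
  have hmem : ∀ x y z : ℂ,
      (c₀ / 2) • tripleShear b' x₁ x₂ y₁ y₂ z₁ z₂ x y z χ ∈ semiSpinor d := fun x y z =>
    Submodule.smul_mem _ _
      (shearSpinor_mem _ _ _ _ (shearSpinor_mem _ _ _ _ (shearSpinor_mem _ _ _ _ hS)))
  refine ⟨_, _, _, _, hmem x y z, hmem (-x) (-y) (-z), hfr x y z, hfr (-x) (-y) (-z), ?_, ?_⟩
  · have := (hfr x y z).basis.finrank_add_card_le
      (ann d ((c₀ / 2) • tripleShear b' x₁ x₂ y₁ y₂ z₁ z₂ x y z χ) ⊓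
        ann d ((c₀ / 2) • tripleShear b' x₁ x₂ y₁ y₂ z₁ z₂ (-x) (-y) (-z) χ))
      [x₁, x₂, y₁, y₂, z₁, z₂].toFinset (fun u hu => (hfr x y z).mem_ann_iff.1 hu.1)
      (fun u hu i hi => by
        obtain ⟨r, hr, j, hj⟩ := tripleShearFamily_sub b b' hn hx hy hz (List.mem_toFinset.1 hi)
        have h := congrArg (metric d u) hj
        rw [metric_sub_right, (hfr x y z).mem_ann_iff.1 hu.1,
          (hfr (-x) (-y) (-z)).mem_ann_iff.1 hu.2, sub_zero, metric_smul_right] at h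
        exact (mul_eq_zero.1 h.symm).resolve_left hr)
    rwa [List.toFinset_card_of_nodup hn] at this
  · rw [← smul_add, tripleShear_add_tripleShear_neg, smul_smul, div_mul_cancel₀ _ two_ne_zero, hyz,
      hxz, hxy, eA, eB, eC]
    simp only [smul_add, smul_smul, mul_div_cancel₀ _ h0]

/-! ### Intersection numbers of configurations -/

theorem four_le_card_symmDiff {d k : ℕ} {ψ : Fin k → Spinor d} (hs : SmallEdges d ψ)
    {b b' : Fin d → V d} {J : Fin k → Finset (Fin d)}
    (hf : ∀ α, IsFrame d (swapFamily b b' (J α)) (swapFamily b' b (J α)) (ψ α)) {α β : Fin k}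
    (h : α ≠ β) : 4 ≤ (J α ∆ J β).card := by
  have h1 := hs α β h
  have h2 := le_finrank_inf_add_card (hf α) (hf β)
  omega

/-- Four members of a configuration whose annihilators share at least `d - 6` dimensions add up to
two pure spinors; these keep the bound on intersections with the other members. -/
theorem IsConfiguration.exists_two_summands {d k : ℕ} {ψ : Fin k → Spinor d}
    (h : IsConfiguration d ψ) {c : Fin k → ℂ} (hc : ∀ α, c α ≠ 0) {α β γ δ : Fin k}
    (hαβ : α ≠ β) (hαγ : α ≠ γ) (hαδ : α ≠ δ) (hβγ : β ≠ γ) (hβδ : β ≠ δ) (hγδ : γ ≠ δ)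
    (ht : d ≤ Module.finrank ℂ
      (ann d (ψ α) ⊓ ann d (ψ β) ⊓ ann d (ψ γ) ⊓ ann d (ψ δ) : Submodule ℂ (V d)) + 6) :
    ∃ φ₁ φ₂ : Spinor d, (φ₁ ∈ semiSpinor d ∧ IsPure d φ₁) ∧ (φ₂ ∈ semiSpinor d ∧ IsPure d φ₂) ∧
      Module.finrank ℂ (ann d φ₁ ⊓ ann d φ₂ : Submodule ℂ (V d)) + 6 ≤ d ∧
      (∀ η, η ≠ α →
        Module.finrank ℂ (ann d φ₁ ⊓ ann d (ψ η) : Submodule ℂ (V d)) + 4 ≤ d ∧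
        Module.finrank ℂ (ann d φ₂ ⊓ ann d (ψ η) : Submodule ℂ (V d)) + 4 ≤ d) ∧
      c α • ψ α + c β • ψ β + c γ • ψ γ + c δ • ψ δ = φ₁ + φ₂ := by
  obtain ⟨b, b', J, hJ, hf'⟩ := h.exists_frames α
  have hf := fun α => (hf' α).2
  have h4 : ∀ {α β : Fin k}, α ≠ β → 4 ≤ (J α ∆ J β).card := fun h' =>
    four_le_card_symmDiff h.2 hf h'
  have h4' : ∀ {η : Fin k}, η ≠ α → 4 ≤ (J η).card := fun h' => by
    have := h4 h'.symm
    rwa [hJ, ← Finset.bot_eq_empty, bot_symmDiff] at this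
  have hα := hf α
  rw [hJ, swapFamily_empty, swapFamily_empty] at hα
  have hb' : ∀ {η : Fin k} {u : V d}, u ∈ ann d (ψ η) → ∀ i ∈ J η, metric d u (b' i) = 0 := by
    intro η u hu i hi
    have := (hf η).mem_ann_iff.1 hu i
    simpa only [swapFamily, hi, if_true] using this
  have h6 : (J β ∪ J γ ∪ J δ).card ≤ 6 := by
    have := hα.basis.finrank_add_card_le
      (ann d (ψ α) ⊓ ann d (ψ β) ⊓ ann d (ψ γ) ⊓ ann d (ψ δ)) (J β ∪ J γ ∪ J δ)
      (fun u hu => hα.mem_ann_iff.1 hu.1.1.1)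
      (fun u hu i hi => by
        rcases Finset.mem_union.1 hi with hi | hi
        · rcases Finset.mem_union.1 hi with hi | hi
          · exact hb' hu.1.1.2 i hi
          · exact hb' hu.1.2 i hi
        · exact hb' hu.2 i hi)
    omega
  obtain ⟨φ₁, φ₂, a₁, a₂, m₁, m₂, f₁, f₂, h12, hsum⟩ :=
    SpinorOrbits.exists_two_summands hα (hf' α).1 (hf β) (hf γ) (hf δ) (h4' hαβ.symm)
      (h4' hαγ.symm) (h4' hαδ.symm) (h4 hβγ) (h4 hβδ) (h4 hγδ) h6 (hc α) (hc β) (hc γ) (hc δ)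
  have hsmall : ∀ {φ : Spinor d} {a₁ : Fin d → V d}, IsFrame d a₁ b' φ → ∀ η, η ≠ α →
      Module.finrank ℂ (ann d φ ⊓ ann d (ψ η) : Submodule ℂ (V d)) + 4 ≤ d := by
    intro φ a₁ f η hη
    have h1 := f.basis.finrank_add_card_le (ann d φ ⊓ ann d (ψ η)) (J η)
      (fun u hu => f.mem_ann_iff.1 hu.1) (fun u hu => hb' hu.2)
    have h2 := h4' hη
    omega
  exact ⟨φ₁, φ₂, ⟨m₁, f₁.isPure⟩, ⟨m₂, f₂.isPure⟩, h12,
    fun η hη => ⟨hsmall f₁ η hη, hsmall f₂ η hη⟩, hsum⟩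

theorem IsConfiguration.isPure {d k : ℕ} {ψ : Fin k → Spinor d} (h : IsConfiguration d ψ)
    (α : Fin k) : ψ α ∈ semiSpinor d ∧ IsPure d (ψ α) := by
  obtain ⟨b, b', J, -, hf⟩ := h.exists_frames α
  exact ⟨(hf α).1, (hf α).2.isPure⟩

theorem spinAct_one (d : ℕ) (ψ : Spinor d) : spinAct d 1 ψ = ψ := by
  simp [spinAct]

/-- Reducibility witnessed by the identity of the spin group and any finite index type. -/
theorem isReducible_of_fintype {d k : ℕ} {ψ : Fin k → Spinor d} {c : Fin k → ℂ} {n : Type}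
    [Fintype n] (hn : Fintype.card n < k) (φ : n → Spinor d) (b : n → ℂ)
    (hφ : ∀ j, φ j ∈ semiSpinor d ∧ IsPure d (φ j))
    (he : ∀ i j, i ≠ j →
      Module.finrank ℂ (ann d (φ i) ⊓ ann d (φ j) : Submodule ℂ (V d)) + 4 ≤ d)
    (hsum : ∑ α, c α • ψ α = ∑ j, b j • φ j) : IsReducible d ψ c := by
  let e := Fintype.equivFin n
  refine ⟨_, hn, fun j => φ (e.symm j), fun j => b (e.symm j), 1, fun j => hφ _,
    fun i j hij => he _ _ fun h => hij (e.symm.injective h), ?_⟩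
  rw [spinAct_one, hsum]
  exact (Equiv.sum_comp e.symm fun j => b j • φ j).symm

/-- If four annihilators share more than `d - 7` dimensions, the combination is reducible. -/
theorem IsConfiguration.isReducible {d k : ℕ} {ψ : Fin k → Spinor d}
    (h : IsConfiguration d ψ) {c : Fin k → ℂ} (hc : ∀ α, c α ≠ 0) {α β γ δ : Fin k}
    (hαβ : α ≠ β) (hαγ : α ≠ γ) (hαδ : α ≠ δ) (hβγ : β ≠ γ) (hβδ : β ≠ δ) (hγδ : γ ≠ δ)
    (ht : d ≤ Module.finrank ℂ
      (ann d (ψ α) ⊓ ann d (ψ β) ⊓ ann d (ψ γ) ⊓ ann d (ψ δ) : Submodule ℂ (V d)) + 6) :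
    IsReducible d ψ c := by
  obtain ⟨φ₁, φ₂, p₁, p₂, h12, hsmall, hsum⟩ :=
    h.exists_two_summands hc hαβ hαγ hαδ hβγ hβδ hγδ ht
  let S : Finset (Fin k) := {α, β, γ, δ}
  have hS : S.card = 4 := by
    simp only [S]
    rw [Finset.card_insert_of_notMem, Finset.card_insert_of_notMem, Finset.card_pair hγδ] <;>
      simp [*]
  have hSk : S.card ≤ k := by simpa using S.card_le_univ
  refine isReducible_of_fintype (n := Bool ⊕ (Sᶜ : Finset (Fin k))) ?_
    (Sum.elim (fun i => if i then φ₁ else φ₂) fun η => ψ η) (Sum.elim (fun _ => 1) fun η => c η)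
    ?_ ?_ ?_
  · rw [Fintype.card_sum, Fintype.card_bool, Fintype.card_coe, Finset.card_compl, Fintype.card_fin,
      hS]
    omega
  · rintro (i | η)
    · cases i
      · exact p₂
      · exact p₁
    · exact h.isPure η
  · have hη : ∀ η : (Sᶜ : Finset (Fin k)), (η : Fin k) ≠ α := by
      intro η hη
      refine Finset.mem_compl.1 η.2 ?_
      rw [hη]
      exact Finset.mem_insert_self _ _
    rintro (i | η) (j | θ) hij
    · cases i <;> cases j
      · exact absurd rfl hij
      · change Module.finrank ℂ (ann d φ₂ ⊓ ann d φ₁ : Submodule ℂ (V d)) + 4 ≤ d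
        rw [inf_comm]
        omega
      · change Module.finrank ℂ (ann d φ₁ ⊓ ann d φ₂ : Submodule ℂ (V d)) + 4 ≤ d
        omega
      · exact absurd rfl hij
    · cases i
      · exact (hsmall θ (hη θ)).2
      · exact (hsmall θ (hη θ)).1
    · rw [inf_comm]
      cases j
      · exact (hsmall η (hη η)).2
      · exact (hsmall η (hη η)).1
    · exact h.2 η θ fun he => hij (congrArg Sum.inr (Subtype.ext he))
  · rw [← Finset.sum_add_sum_compl S, Fintype.sum_sum_type, Fintype.sum_bool]
    congr 1
    · simp only [S]
      rw [Finset.sum_insert, Finset.sum_insert, Finset.sum_pair hγδ]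
      · simp only [Sum.elim_inl, if_true, Bool.false_eq_true, if_false, one_smul]
        rw [← hsum]
        abel
      · simp [*]
      · simp [*]
    · exact (Finset.sum_coe_sort Sᶜ fun η => c η • ψ η).symm

/-- The exchanged sets have size exactly four: two sets of size at least four and at distance at
least four in a set of size six have size four. -/
theorem IsConfiguration.finrank_inf_eq_two {ψ : Fin 4 → Spinor 6} (h : IsConfiguration 6 ψ)
    {α β : Fin 4} (hαβ : α ≠ β) :
    Module.finrank ℂ (ann 6 (ψ α) ⊓ ann 6 (ψ β) : Submodule ℂ (V 6)) = 2 := by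
  obtain ⟨b, b', J, hJ, hf'⟩ := h.exists_frames α
  have hf := fun α => (hf' α).2
  have h4 : ∀ {α β : Fin 4}, α ≠ β → 4 ≤ (J α ∆ J β).card := fun h' =>
    four_le_card_symmDiff h.2 hf h'
  have h4' : ∀ {η : Fin 4}, η ≠ α → 4 ≤ (J η).card := fun h' => by
    have := h4 h'.symm
    rwa [hJ, ← Finset.bot_eq_empty, bot_symmDiff] at this
  have h1 := le_finrank_inf_add_card (hf α) (hf β)
  have h2 := h.2 α β hαβ
  have h3 : ∀ α β : Fin 4, ∃ γ : Fin 4, γ ≠ α ∧ γ ≠ β := by decide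
  obtain ⟨γ, hγα, hγβ⟩ := h3 α β
  have h5 := card_symmDiff_add_card_inter (J β) (J γ)
  have h6 := Finset.card_union_add_card_inter (J β) (J γ)
  have h7 := (J β ∪ J γ).card_le_univ
  rw [Fintype.card_fin] at h7
  have h8 := h4 hγβ.symm
  have h9 := h4' hγα
  have h10 := h4' hαβ.symm
  rw [hJ, ← Finset.bot_eq_empty, bot_symmDiff] at h1
  omega

theorem IsConfiguration.inf_inf_eq_bot {ψ : Fin 4 → Spinor 6} (h : IsConfiguration 6 ψ)
    {α β γ : Fin 4} (hαβ : α ≠ β) (hαγ : α ≠ γ) (hβγ : β ≠ γ) :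
    ann 6 (ψ α) ⊓ ann 6 (ψ β) ⊓ ann 6 (ψ γ) = ⊥ := by
  obtain ⟨b, b', J, hJ, hf'⟩ := h.exists_frames α
  have hf := fun α => (hf' α).2
  have h4 : ∀ {α β : Fin 4}, α ≠ β → 4 ≤ (J α ∆ J β).card := fun h' =>
    four_le_card_symmDiff h.2 hf h'
  have hb' : ∀ {η : Fin 4} {u : V 6}, u ∈ ann 6 (ψ η) → ∀ i ∈ J η, metric 6 u (b' i) = 0 := by
    intro η u hu i hi
    have := (hf η).mem_ann_iff.1 hu i
    simpa only [swapFamily, hi, if_true] using this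
  have hα := hf α
  rw [hJ, swapFamily_empty, swapFamily_empty] at hα
  have h1 := h4 hαβ
  have h2 := h4 hαγ
  have h3 := h4 hβγ
  rw [hJ, ← Finset.bot_eq_empty, bot_symmDiff] at h1 h2
  have hU : J β ∪ J γ = Finset.univ := by
    refine Finset.eq_univ_of_card _ ?_
    have h5 := card_symmDiff_add_card_inter (J β) (J γ)
    have h6 := Finset.card_union_add_card_inter (J β) (J γ)
    have h7 := (J β ∪ J γ).card_le_univ
    rw [Fintype.card_fin] at h7 ⊢
    omega
  rw [eq_bot_iff]
  rintro u ⟨⟨hu1, hu2⟩, hu3⟩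
  refine hα.basis.eq_zero (hα.mem_ann_iff.1 hu1) fun i => ?_
  have hi : i ∈ J β ∪ J γ := by rw [hU]; exact Finset.mem_univ i
  rcases Finset.mem_union.1 hi with hi | hi
  · exact hb' hu2 i hi
  · exact hb' hu3 i hi

/-- Any combination of a configuration of four in twelve dimensions is the sum of two pure spinors
with complementary annihilators. -/
theorem IsConfiguration.exists_eq_add {ψ : Fin 4 → Spinor 6} (h : IsConfiguration 6 ψ)
    {c : Fin 4 → ℂ} (hc : ∀ α, c α ≠ 0) : ∃ φ₁ φ₂ : Spinor 6,
      (φ₁ ∈ semiSpinor 6 ∧ IsPure 6 φ₁) ∧ (φ₂ ∈ semiSpinor 6 ∧ IsPure 6 φ₂) ∧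
      ann 6 φ₁ ⊓ ann 6 φ₂ = ⊥ ∧ ∑ α, c α • ψ α = φ₁ + φ₂ := by
  obtain ⟨φ₁, φ₂, p₁, p₂, h12, -, hsum⟩ := h.exists_two_summands hc
    (α := 0) (β := 1) (γ := 2) (δ := 3) (by decide) (by decide) (by decide) (by decide)
    (by decide) (by decide) (Nat.le_add_left 6 _)
  refine ⟨φ₁, φ₂, p₁, p₂, ?_, ?_⟩
  · exact Submodule.finrank_eq_zero.1 (by omega)
  · rw [Fin.sum_univ_four, hsum]

/-! ### The vector representation of the spin group -/

theorem cliffordι_injective (d : ℕ) : Function.Injective (ι (Q d)) := by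
  intro u v h
  have h' := congrArg (changeForm (changeForm.associated_neg_proof (Q := Q d))) h
  rw [changeForm_ι, changeForm_ι] at h'
  exact (ExteriorAlgebra.ι_inj ℂ u v).1 h'

theorem exists_ι_eq_conj {d : ℕ} (g : Spin d) (v : V d) :
    ∃ w, ι (Q d) w = (g : CliffordAlgebra (Q d)) * ι (Q d) v *
      ((g⁻¹ : Spin d) : CliffordAlgebra (Q d)) := by
  obtain ⟨w, hw⟩ := spinGroup.conjAct_smul_ι_mem_range_ι (x := spinGroup.toUnits g) g.2 v
  exact ⟨w, hw⟩

/-- The action of the spin group on vectors by conjugation. -/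
def vecAct {d : ℕ} (g : Spin d) : V d →ₗ[ℂ] V d where
  toFun v := (exists_ι_eq_conj g v).choose
  map_add' u v := cliffordι_injective d <| (exists_ι_eq_conj g _).choose_spec.trans <| by
    rw [map_add, map_add, (exists_ι_eq_conj g u).choose_spec, (exists_ι_eq_conj g v).choose_spec,
      mul_add, add_mul]
  map_smul' r v := cliffordι_injective d <| (exists_ι_eq_conj g _).choose_spec.trans <| by
    rw [map_smul, map_smul, (exists_ι_eq_conj g v).choose_spec, mul_smul_comm, smul_mul_assoc,
      RingHom.id_apply]

theorem ι_vecAct {d : ℕ} (g : Spin d) (v : V d) :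
    ι (Q d) (vecAct g v) = (g : CliffordAlgebra (Q d)) * ι (Q d) v *
      ((g⁻¹ : Spin d) : CliffordAlgebra (Q d)) :=
  (exists_ι_eq_conj g v).choose_spec

theorem coe_inv_mul {d : ℕ} (g : Spin d) :
    ((g⁻¹ : Spin d) : CliffordAlgebra (Q d)) * (g : CliffordAlgebra (Q d)) = 1 := by
  rw [← Submonoid.coe_mul, inv_mul_cancel, Submonoid.coe_one]

theorem coe_mul_inv {d : ℕ} (g : Spin d) :
    (g : CliffordAlgebra (Q d)) * ((g⁻¹ : Spin d) : CliffordAlgebra (Q d)) = 1 := by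
  rw [← Submonoid.coe_mul, mul_inv_cancel, Submonoid.coe_one]

theorem vecAct_eq_of_mul_eq {d : ℕ} {g : Spin d} {v w : V d}
    (h : (g : CliffordAlgebra (Q d)) * ι (Q d) v = ι (Q d) w * g) : vecAct g v = w :=
  cliffordι_injective d <| by rw [ι_vecAct, h, mul_assoc, coe_mul_inv, mul_one]

theorem vecAct_mul {d : ℕ} (g h : Spin d) (v : V d) :
    vecAct (g * h) v = vecAct g (vecAct h v) :=
  cliffordι_injective d <| by
    rw [ι_vecAct, ι_vecAct, ι_vecAct, mul_inv_rev, Submonoid.coe_mul, Submonoid.coe_mul]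
    simp only [mul_assoc]

theorem vecAct_one {d : ℕ} (v : V d) : vecAct (1 : Spin d) v = v :=
  vecAct_eq_of_mul_eq (by rw [Submonoid.coe_one, one_mul, mul_one])

theorem vecAct_inv_vecAct {d : ℕ} (g : Spin d) (v : V d) : vecAct g⁻¹ (vecAct g v) = v := by
  rw [← vecAct_mul, inv_mul_cancel, vecAct_one]

theorem vecAct_vecAct_inv {d : ℕ} (g : Spin d) (v : V d) : vecAct g (vecAct g⁻¹ v) = v := by
  rw [← vecAct_mul, mul_inv_cancel, vecAct_one]

theorem spinAct_mul {d : ℕ} (g h : Spin d) (ψ : Spinor d) :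
    spinAct d (g * h) ψ = spinAct d g (spinAct d h ψ) := by
  simp only [spinAct, Submonoid.coe_mul, map_mul, Module.End.mul_apply]

theorem spinAct_inv_spinAct {d : ℕ} (g : Spin d) (ψ : Spinor d) :
    spinAct d g⁻¹ (spinAct d g ψ) = ψ := by
  rw [← spinAct_mul, inv_mul_cancel, spinAct_one]

theorem spinAct_spinAct_inv {d : ℕ} (g : Spin d) (ψ : Spinor d) :
    spinAct d g (spinAct d g⁻¹ ψ) = ψ := by
  rw [← spinAct_mul, mul_inv_cancel, spinAct_one]

theorem spinAct_add {d : ℕ} (g : Spin d) (ψ φ : Spinor d) :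
    spinAct d g (ψ + φ) = spinAct d g ψ + spinAct d g φ :=
  map_add _ _ _

theorem spinAct_smul {d : ℕ} (g : Spin d) (r : ℂ) (ψ : Spinor d) :
    spinAct d g (r • ψ) = r • spinAct d g ψ :=
  map_smul _ _ _

theorem spinAct_eq_zero_iff {d : ℕ} (g : Spin d) {ψ : Spinor d} :
    spinAct d g ψ = 0 ↔ ψ = 0 := by
  refine ⟨fun h => ?_, fun h => by rw [h]; exact map_zero _⟩
  rw [← spinAct_inv_spinAct g ψ, h]
  exact map_zero _

theorem vectorAct_vecAct {d : ℕ} (g : Spin d) (u : V d) (ψ : Spinor d) :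
    vectorAct d (vecAct g u) (spinAct d g ψ) = spinAct d g (vectorAct d u ψ) := by
  rw [spinAct, spinAct, ← spinorRep_ι, ← spinorRep_ι, ι_vecAct, ← Module.End.mul_apply,
    ← Module.End.mul_apply, ← map_mul, ← map_mul, mul_assoc, coe_inv_mul, mul_one]

theorem metric_vecAct {d : ℕ} (g : Spin d) (u v : V d) :
    metric d (vecAct g u) (vecAct g v) = metric d u v := by
  have h := vectorAct_anticomm d (vecAct g u) (vecAct g v) (spinAct d g 1)
  rw [vectorAct_vecAct, vectorAct_vecAct, vectorAct_vecAct, vectorAct_vecAct,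
    vectorAct_anticomm d u v, eq_sub_iff_add_eq, ← spinAct_add, sub_add_cancel, spinAct_smul] at h
  have h1 : spinAct d g 1 ≠ 0 := by
    rw [Ne, spinAct_eq_zero_iff]
    exact one_ne_zero
  exact (smul_left_injective ℂ h1 h).symm

theorem IsCanonicalBasis.vecAct {d : ℕ} {a a' : Fin d → V d} (h : IsCanonicalBasis d a a')
    (g : Spin d) :
    IsCanonicalBasis d (fun i => vecAct g (a i)) fun i => SpinorOrbits.vecAct g (a' i) where
  null i j := by rw [metric_vecAct, h.null]
  null' i j := by rw [metric_vecAct, h.null']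
  pairing i j := by rw [metric_vecAct, h.pairing]

theorem wedge_vecAct {d : ℕ} (g : Spin d) (x y u v : V d) :
    wedge d (vecAct g x) (vecAct g y) (vecAct g u) (vecAct g v) = wedge d x y u v := by
  simp only [wedge, metric_vecAct]

/-! ### The invariant inner product in twelve dimensions -/

/-- The reversal of forms. -/
abbrev rev (d : ℕ) : Spinor d →ₗ[ℂ] Spinor d := reverse (Q := (0 : QuadraticForm ℂ (Fin d → ℂ)))

/-- The parity involution of forms. -/
abbrev par (d : ℕ) : Spinor d →ₐ[ℂ] Spinor d := involute (Q := (0 : QuadraticForm ℂ (Fin d → ℂ)))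

/-- The contraction of forms with a covector. -/
abbrev contr (d : ℕ) (f : Module.Dual ℂ (Fin d → ℂ)) : Spinor d →ₗ[ℂ] Spinor d :=
  contractLeft (Q := (0 : QuadraticForm ℂ (Fin d → ℂ))) f

theorem contr_ι_mul (d : ℕ) (f : Module.Dual ℂ (Fin d → ℂ)) (x : Fin d → ℂ) (ψ : Spinor d) :
    contr d f (ExteriorAlgebra.ι ℂ x * ψ) = f x • ψ - ExteriorAlgebra.ι ℂ x * contr d f ψ :=
  contractLeft_extι_mul f x ψ

theorem par_contr (d : ℕ) (f : Module.Dual ℂ (Fin d → ℂ)) (ψ : Spinor d) :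
    par d (contr d f ψ) = -contr d f (par d ψ) := by
  induction ψ using CliffordAlgebra.left_induction with
  | algebraMap r => simp
  | add x y hx hy => rw [map_add, map_add, hx, hy, map_add, map_add, neg_add]
  | ι_mul x v hx =>
    rw [contractLeft_ι_mul, map_sub, map_smul, map_mul, hx, map_mul, involute_ι, neg_mul,
      neg_mul, map_neg (contr d f), contractLeft_ι_mul]
    noncomm_ring

theorem contr_mul (d : ℕ) (f : Module.Dual ℂ (Fin d → ℂ)) (ψ φ : Spinor d) :
    contr d f (ψ * φ) = contr d f ψ * φ + par d ψ * contr d f φ := by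
  induction ψ using CliffordAlgebra.left_induction with
  | algebraMap r => simp [contractLeft_algebraMap_mul]
  | add x y hx hy => rw [add_mul, map_add, hx, hy, map_add, map_add]; noncomm_ring
  | ι_mul x v hx =>
    rw [mul_assoc, contractLeft_ι_mul, hx, contractLeft_ι_mul, map_mul, involute_ι, sub_mul,
      smul_mul_assoc]
    noncomm_ring

theorem ι_mul_eq_par_mul_ι (d : ℕ) (x : Fin d → ℂ) (ψ : Spinor d) :
    ExteriorAlgebra.ι ℂ x * ψ = par d ψ * ExteriorAlgebra.ι ℂ x := by
  have h := ι_mul_sub_involute_mul_ι (0 : QuadraticForm ℂ (Fin d → ℂ)) x ψ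
  have h0 : QuadraticMap.polarBilin (0 : QuadraticForm ℂ (Fin d → ℂ)) x = 0 := by
    ext; simp [QuadraticMap.polar]
  rw [h0, map_zero, LinearMap.zero_apply, sub_eq_zero] at h
  exact h

theorem contr_rev (d : ℕ) (f : Module.Dual ℂ (Fin d → ℂ)) (ψ : Spinor d) :
    contr d f (rev d ψ) = par d (rev d (contr d f ψ)) := by
  induction ψ using CliffordAlgebra.left_induction with
  | algebraMap r => simp
  | add x y hx hy => rw [map_add, map_add, hx, hy, map_add, map_add, map_add]
  | ι_mul x v hx =>
    have h1 : contr d f (CliffordAlgebra.ι 0 v) = algebraMap ℂ _ (f v) := contractLeft_ι _ _ _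
    rw [reverse.map_mul, reverse_ι, contr_mul, hx, h1, contractLeft_ι_mul, map_sub, map_sub,
      map_smul, map_smul, reverse.map_mul, reverse_ι, map_mul, involute_ι, Algebra.smul_def,
      Algebra.commutes]
    noncomm_ring

/-- An iterated contraction vanishes on `f_j ⌋ ψ` if `f_j` is among the covectors, since
contractions anticommute and square to zero. -/
theorem foldl_contr_contr (d : ℕ) (f : Fin d → Module.Dual ℂ (Fin d → ℂ)) (l : List (Fin d))
    (j : Fin d) (ψ : Spinor d) (F : Spinor d →ₗ[ℂ] Spinor d)
    (h : j ∈ l ∨ F (contr d (f j) ψ) = 0)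
    (hF : ∃ r : ℂ, F (contr d (f j) ψ) = r • contr d (f j) (F ψ)) :
    l.foldl (fun F i => contr d (f i) ∘ₗ F) F (contr d (f j) ψ) = 0 := by
  induction l generalizing F with
  | nil => exact h.resolve_left List.not_mem_nil
  | cons i l ih =>
    rw [List.foldl_cons]
    obtain ⟨r, hr⟩ := hF
    refine ih _ ?_ ⟨-r, ?_⟩
    · by_cases hij : j = i
      · right
        rw [LinearMap.comp_apply, hr, map_smul, hij, contractLeft_contractLeft, smul_zero]
      · rcases h with h | h
        · exact Or.inl ((List.mem_cons.1 h).resolve_left hij)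
        · right; rw [LinearMap.comp_apply, h, map_zero]
    · rw [LinearMap.comp_apply, hr, map_smul, LinearMap.comp_apply, contractLeft_comm, smul_neg,
        neg_smul]

theorem topCoeff_contr (d : ℕ) (f : Module.Dual ℂ (Fin d → ℂ)) (ψ : Spinor d) :
    topCoeff d (contr d f ψ) = 0 := by
  have hf : f = ∑ i, f (Pi.single i 1) • (LinearMap.proj i : Module.Dual ℂ (Fin d → ℂ)) := by
    refine LinearMap.pi_ext' fun j => LinearMap.ext_ring ?_
    simp [Pi.single_apply]
  have h0 : ∀ j, topCoeff d (contr d (LinearMap.proj j) ψ) = 0 := by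
    intro j
    have := foldl_contr_contr d (fun i => (LinearMap.proj i : (Fin d → ℂ) →ₗ[ℂ] ℂ))
      (List.finRange d) j ψ LinearMap.id (Or.inl (List.mem_finRange j)) ⟨1, by simp⟩
    rw [topCoeff, LinearMap.comp_apply]
    exact (congrArg _ this).trans (map_zero _)
  rw [hf]
  simp only [contr] at h0 ⊢
  rw [map_sum, LinearMap.sum_apply, map_sum]
  refine Finset.sum_eq_zero fun j _ => ?_
  rw [map_smul, LinearMap.smul_apply, map_smul, h0, smul_zero]

theorem topCoeff_par (ψ : Spinor 6) : topCoeff 6 (par 6 ψ) = topCoeff 6 ψ := by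
  have h : (ExteriorAlgebra.algebraMapInv (R := ℂ) (M := Fin 6 → ℂ)).comp (par 6) =
      ExteriorAlgebra.algebraMapInv := by
    refine ExteriorAlgebra.hom_ext (LinearMap.ext fun v => ?_)
    have h1 : par 6 (ExteriorAlgebra.ι ℂ v) = -ExteriorAlgebra.ι ℂ v := involute_ι v
    have h2 : ExteriorAlgebra.algebraMapInv (ExteriorAlgebra.ι ℂ v) = (0 : ℂ) := by
      simp [ExteriorAlgebra.algebraMapInv]
    rw [LinearMap.comp_apply, LinearMap.comp_apply, AlgHom.toLinearMap_apply,
      AlgHom.toLinearMap_apply, AlgHom.comp_apply, h1, map_neg, h2, neg_zero]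
  have hc : ∀ (f : Module.Dual ℂ (Fin 6 → ℂ)) (χ : Spinor 6),
      contr 6 f (par 6 χ) = -par 6 (contr 6 f χ) := fun f χ => by rw [par_contr, neg_neg]
  have hl : List.finRange 6 = [0, 1, 2, 3, 4, 5] := rfl
  simp only [topCoeff, LinearMap.comp_apply, hl, List.foldl_cons, List.foldl_nil,
    LinearMap.id_apply, AlgHom.toLinearMap_apply]
  simp only [hc, map_neg, neg_neg]
  exact DFunLike.congr_fun h _

theorem inner_add_left (ψ φ χ : Spinor 6) : inner 6 (ψ + φ) χ = inner 6 ψ χ + inner 6 φ χ := by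
  simp only [inner, add_mul, map_add]

theorem inner_add_right (ψ φ χ : Spinor 6) : inner 6 χ (ψ + φ) = inner 6 χ ψ + inner 6 χ φ := by
  simp only [inner, mul_add, map_add]

/-- Vectors are skew for the inner product: contraction is a graded derivation whose values have no
top component, and in even degree the top component is fixed by the parity involution. -/
theorem inner_vectorAct_left (u : V 6) (ψ φ : Spinor 6) :
    inner 6 (vectorAct 6 u ψ) φ = -inner 6 ψ (vectorAct 6 u φ) := by
  have hf : topCoeff 6 (contr 6 u.1 ψ * rev 6 φ) = -topCoeff 6 (ψ * rev 6 (contr 6 u.1 φ)) := by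
    have h := topCoeff_contr 6 u.1 (ψ * rev 6 φ)
    rw [contr_mul, contr_rev, ← map_mul, map_add, topCoeff_par] at h
    exact eq_neg_of_add_eq_zero_left h
  have hx : topCoeff 6 (ExteriorAlgebra.ι ℂ u.2 * ψ * rev 6 φ) =
      -topCoeff 6 (ψ * rev 6 (ExteriorAlgebra.ι ℂ u.2 * φ)) := by
    have h1 : rev 6 (ExteriorAlgebra.ι ℂ u.2 * φ) = rev 6 φ * ExteriorAlgebra.ι ℂ u.2 := by
      rw [reverse.map_mul]
      congr 1
      exact reverse_ι u.2
    have h2 : par 6 (ExteriorAlgebra.ι ℂ u.2) = -ExteriorAlgebra.ι ℂ u.2 := involute_ι u.2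
    rw [h1, mul_assoc, ι_mul_eq_par_mul_ι, ← topCoeff_par (_ * (_ * _)), ← mul_assoc,
      map_mul (par 6) _ (ExteriorAlgebra.ι ℂ u.2), h2, mul_neg, map_neg, neg_neg]
  simp only [inner, vectorAct_apply, add_mul, map_add, mul_add, neg_add]
  exact congrArg₂ (· + ·) hf hx

theorem inner_spinorRep_left (g : CliffordAlgebra (Q 6)) (ψ φ : Spinor 6) :
    inner 6 (spinorRep 6 g ψ) φ = inner 6 ψ (spinorRep 6 (star g) φ) := by
  induction g using CliffordAlgebra.induction generalizing ψ φ with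
  | algebraMap r =>
    rw [star_algebraMap, AlgHom.commutes, Module.algebraMap_end_apply, Module.algebraMap_end_apply]
    simp only [inner, smul_mul_assoc, map_smul, mul_smul_comm]
  | ι v =>
    rw [star_ι, map_neg, LinearMap.neg_apply, spinorRep_ι, inner_vectorAct_left]
    simp only [inner, map_neg, mul_neg]
  | mul a b ha hb =>
    rw [star_mul, map_mul, map_mul, Module.End.mul_apply, Module.End.mul_apply, ha, hb]
  | add a b ha hb =>
    rw [star_add, map_add, map_add, LinearMap.add_apply, LinearMap.add_apply]
    rw [inner_add_left, inner_add_right, ha, hb]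

theorem inner_spinAct (g : Spin 6) (ψ φ : Spinor 6) :
    inner 6 (spinAct 6 g ψ) (spinAct 6 g φ) = inner 6 ψ φ := by
  rw [spinAct, spinAct, inner_spinorRep_left, ← Module.End.mul_apply, ← map_mul,
    spinGroup.star_mul_self_of_mem g.2, map_one, Module.End.one_apply]

theorem B₂_spinAct (g : Spin 6) (ψ : Spinor 6) (u v : V 6) :
    B₂ 6 (spinAct 6 g ψ) (vecAct g u) (vecAct g v) = B₂ 6 ψ u v := by
  simp only [B₂, vectorAct_vecAct, inner_spinAct]

theorem B₂_smul (r : ℂ) (ψ : Spinor 6) (u v : V 6) :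
    B₂ 6 (r • ψ) u v = r ^ 2 * B₂ 6 ψ u v := by
  simp only [B₂, inner, map_smul, smul_mul_assoc, mul_smul_comm, smul_eq_mul]
  ring

/-! ### Normal form of pairs of complementary pure spinors -/

/-- The spin group is transitive on frames with even vacuum, up to the scale of the vacuum: an odd
element of the pin group would change the parity of the vacuum. -/
theorem IsFrame.exists_spin {d : ℕ} {a a' c c' : Fin d → V d} {χ χ' : Spinor d}
    (h : IsFrame d a a' χ) (h' : IsFrame d c c' χ') (hχ : χ ∈ semiSpinor d)
    (hχ' : χ' ∈ semiSpinor d) : ∃ g : Spin d, (∀ i, vecAct g (a i) = c i) ∧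
      (∀ i, vecAct g (a' i) = c' i) ∧ ∃ r : ℂ, r ≠ 0 ∧ spinAct d g χ = r • χ' := by
  obtain ⟨g, hg⟩ := h.basis.exists_intertwines h'.basis
  obtain ⟨r, hr⟩ := h'.exists_smul (χ' := spinorRep d g χ) fun i =>
    hg.vectorAct_eq_zero (j := Sum.inl i) (h.kills i)
  have hne : spinorRep d g χ ≠ 0 := fun h0 =>
    h.ne_zero (spinorRep_injective_of_mem_pinGroup hg.1 (h0.trans (map_zero _).symm))
  rcases hg.2 with ⟨he, hv⟩ | ⟨ho, -⟩
  · refine ⟨⟨g, hg.1, he⟩, fun i => vecAct_eq_of_mul_eq (hv (Sum.inl i)),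
      fun i => vecAct_eq_of_mul_eq (hv (Sum.inr i)), r, ?_, hr⟩
    rintro rfl
    exact hne (by rw [hr, zero_smul])
  · have h1 : spinorRep d g χ ∈ parityPart d 1 :=
      spinorRep_mem_parityPart (add_zero 1) ho hχ
    have h0 : spinorRep d g χ ∈ parityPart d 0 := by
      rw [hr]; exact Submodule.smul_mem _ _ hχ'
    exact absurd (Submodule.disjoint_def.1 (evenOdd_isCompl _).disjoint _ h0 h1) hne

theorem one_mem_semiSpinor (d : ℕ) : (1 : Spinor d) ∈ semiSpinor d :=
  one_le_evenOdd_zero _ (Submodule.mem_one.2 ⟨1, map_one _⟩)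

/-- The form `e^1 ∧ ⋯ ∧ e^d`. -/
def topForm (d : ℕ) : Spinor d := listSpinor d (stdB d) 1 (List.finRange d)

theorem isFrame_one (d : ℕ) : IsFrame d (stdA d) (stdB d) 1 :=
  ⟨isCanonicalBasis_std d, one_ne_zero, fun i => by
    rw [vectorAct_apply, stdA, contractLeft_one, map_zero, zero_mul, add_zero]⟩

theorem isFrame_topForm (d : ℕ) : IsFrame d (stdB d) (stdA d) (topForm d) := by
  have h := (isFrame_one d).listSpinor (List.nodup_finRange d)
  have h1 : ∀ a a' : Fin d → V d, swapFamily a a' (List.finRange d).toFinset = a' := by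
    intro a a'; funext i; simp [swapFamily]
  rwa [h1, h1] at h

/-- Complementary null subspaces of dimension `d` are dual to each other under the metric, so a
basis of one has a dual basis in the other. -/
theorem exists_dual_bases {d : ℕ} {A B : Submodule ℂ (V d)} (hA : Module.finrank ℂ A = d)
    (hB : Module.finrank ℂ B = d) (iA : ∀ u ∈ A, ∀ v ∈ A, metric d u v = 0)
    (iB : ∀ u ∈ B, ∀ v ∈ B, metric d u v = 0) (hAB : A ⊓ B = ⊥) :
    ∃ a a' : Fin d → V d, IsCanonicalBasis d a a' ∧ A = Submodule.span ℂ (Set.range a) ∧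
      B = Submodule.span ℂ (Set.range a') := by
  have hsup : A ⊔ B = ⊤ := by
    apply Submodule.eq_top_of_finrank_eq
    have := Submodule.finrank_sup_add_finrank_inf_eq A B
    rw [hAB, finrank_bot, hA, hB] at this
    rw [finrank_V]
    omega
  let bA := Module.finBasisOfFinrankEq ℂ A hA
  let L : B →ₗ[ℂ] (Fin d → ℂ) :=
    LinearMap.pi fun i => (QuadraticMap.polarBilin (Q d)).flip (bA i) ∘ₗ B.subtype
  have hLi : Function.Injective L := by
    refine (injective_iff_map_eq_zero L).2 fun n hn => Subtype.ext ?_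
    refine eq_zero_of_metric_eq_zero d fun v => ?_
    have hv : v ∈ A ⊔ B := by rw [hsup]; trivial
    obtain ⟨x, hx, y, hy, rfl⟩ := Submodule.mem_sup.1 hv
    rw [metric_add_right, iB _ n.2 _ hy, add_zero]
    have hx' : x = ∑ i, bA.repr ⟨x, hx⟩ i • (bA i : V d) := by
      have h := congrArg Subtype.val (bA.sum_repr ⟨x, hx⟩)
      rw [Submodule.coe_sum] at h
      exact h.symm
    rw [hx', metric_sum_right]
    refine Finset.sum_eq_zero fun i _ => ?_
    rw [metric_smul_right]
    exact mul_eq_zero_of_right _ (congrFun hn i)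
  have hLs : Function.Surjective L :=
    (LinearMap.injective_iff_surjective_of_finrank_eq_finrank
      (by rw [hB, Module.finrank_fin_fun])).1 hLi
  choose y hy using fun i : Fin d => hLs (Pi.single i 1)
  have hc : IsCanonicalBasis d (fun i => (bA i : V d)) fun i => (y i : V d) := by
    refine ⟨fun i j => iA _ (bA i).2 _ (bA j).2, fun i j => iB _ (y i).2 _ (y j).2, fun i j => ?_⟩
    have h := congrFun (hy j) i
    rw [metric_comm]
    rw [Pi.single_apply] at h
    exact h
  refine ⟨_, _, hc, ?_, ?_⟩
  · refine (Submodule.eq_of_le_of_finrank_eq ?_ ?_).symm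
    · rw [Submodule.span_le]; rintro _ ⟨i, rfl⟩; exact (bA i).2
    · rw [hc.finrank_span, hA]
  · refine (Submodule.eq_of_le_of_finrank_eq ?_ ?_).symm
    · rw [Submodule.span_le]; rintro _ ⟨i, rfl⟩; exact (y i).2
    · rw [hc.symm.finrank_span, hB]

/-- The torus element scaling a vacuum by `-b⁻¹` and the opposite vacuum by `-b`. -/
theorem exists_torus {d : ℕ} {a a' : Fin d → V d} (h : IsCanonicalBasis d a a') (i : Fin d)
    {χ χ' : Spinor d} (hχ : vectorAct d (a i) χ = 0) (hχ' : vectorAct d (a' i) χ' = 0) {b : ℂ}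
    (hb : b ≠ 0) : ∃ g : Spin d, spinAct d g χ = (-b⁻¹) • χ ∧ spinAct d g χ' = (-b) • χ' := by
  have hQ : ∀ r : ℂ, r ≠ 0 → Q d (r⁻¹ • a' i - r • a i) = -1 := by
    intro r hr
    have h1 := metric_self d (r⁻¹ • a' i - r • a i)
    simp only [metric_sub_left, metric_sub_right, metric_smul_left, metric_smul_right, h.null,
      h.null', h.pairing, h.pairing', if_true] at h1
    refine mul_left_cancel₀ (two_ne_zero (α := ℂ)) (h1.symm.trans ?_)
    field_simp
    ring
  have h1 := ι_mem_pinGroup (hQ 1 one_ne_zero)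
  have h2 := ι_mem_pinGroup (hQ b hb)
  have key : ∀ ψ, spinorRep d (ι (Q d) ((1 : ℂ)⁻¹ • a' i - (1 : ℂ) • a i) *
      ι (Q d) (b⁻¹ • a' i - b • a i)) ψ = vectorAct d (a' i - a i)
        (b⁻¹ • vectorAct d (a' i) ψ - b • vectorAct d (a i) ψ) := by
    intro ψ
    rw [map_mul, Module.End.mul_apply, spinorRep_ι, spinorRep_ι, inv_one, one_smul, one_smul,
      map_sub (vectorAct d) (b⁻¹ • a' i), map_smul (vectorAct d), map_smul (vectorAct d),
      LinearMap.sub_apply, LinearMap.smul_apply, LinearMap.smul_apply]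
  refine ⟨⟨_, Submonoid.mul_mem _ h1 h2, ι_mul_ι_mem_evenOdd_zero _ _ _⟩, ?_, ?_⟩
  · refine (key χ).trans ?_
    rw [hχ, smul_zero, sub_zero, map_smul, map_sub, LinearMap.sub_apply, h.vectorAct_right_self,
      vectorAct_anticomm, hχ, h.pairing, if_pos rfl, map_zero]
    module
  · refine (key χ').trans ?_
    rw [hχ', smul_zero, zero_sub, map_neg, map_smul, map_sub, LinearMap.sub_apply,
      h.symm.vectorAct_right_self, vectorAct_anticomm, hχ', h.pairing', if_pos rfl, map_zero]
    module

/-- Any pair of even pure spinors with complementary annihilators is carried by the spin group to a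
multiple of the pair `1`, `e^1 ∧ ⋯ ∧ e^d`. -/
theorem exists_spinAct_eq_one_topForm {d : ℕ} (hd : 0 < d) {φA φB : Spinor d}
    (hA : φA ∈ semiSpinor d) (pA : IsPure d φA) (pB : IsPure d φB)
    (hAB : ann d φA ⊓ ann d φB = ⊥) : ∃ g : Spin d, ∃ s : ℂ, s ≠ 0 ∧
      spinAct d g φA = s • (1 : Spinor d) ∧ spinAct d g φB = s • topForm d := by
  obtain ⟨a, a', hc, sA, sB⟩ := exists_dual_bases pA.2 pB.2
    (fun u hu v hv => metric_eq_zero_of_mem_ann pA.1 hu hv)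
    (fun u hu v hv => metric_eq_zero_of_mem_ann pB.1 hu hv) hAB
  have fA : IsFrame d a a' φA := ⟨hc, pA.1, fun i => by
    rw [← mem_ann, sA]; exact Submodule.subset_span ⟨i, rfl⟩⟩
  have kB : ∀ i, vectorAct d (a' i) φB = 0 := fun i => by
    rw [← mem_ann, sB]; exact Submodule.subset_span ⟨i, rfl⟩
  obtain ⟨g, -, hg', r, hr, hgA⟩ := fA.exists_spin (isFrame_one d) hA (one_mem_semiSpinor d)
  obtain ⟨r', hgB⟩ := (isFrame_topForm d).exists_smul (χ' := spinAct d g φB) fun i => by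
    rw [← hg', vectorAct_vecAct, kB, spinAct_eq_zero_iff]
  have hr' : r' ≠ 0 := by
    rintro rfl
    rw [zero_smul, spinAct_eq_zero_iff] at hgB
    exact pB.1 hgB
  obtain ⟨b, hb⟩ := exists_sq_eq (r / r')
  have hb0 : b ≠ 0 := by
    rintro rfl
    rw [zero_pow two_ne_zero] at hb
    exact div_ne_zero hr hr' hb.symm
  obtain ⟨t, ht, ht'⟩ := exists_torus (isCanonicalBasis_std d) ⟨0, hd⟩
    ((isFrame_one d).kills _) ((isFrame_topForm d).kills _) hb0
  refine ⟨t * g, r' * -b, mul_ne_zero hr' (neg_ne_zero.2 hb0), ?_, ?_⟩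
  · rw [spinAct_mul, hgA, spinAct_smul, ht, smul_smul]
    congr 1
    have : r = b ^ 2 * r' := by rw [hb, div_mul_cancel₀ _ hr']
    rw [this]
    field_simp
  · rw [spinAct_mul, hgB, spinAct_smul, ht', smul_smul]

/-! ### The 2-form of the standard pair -/

theorem vectorAct_stdB (d : ℕ) (i : Fin d) (ψ : Spinor d) :
    vectorAct d (stdB d i) ψ = ExteriorAlgebra.ι ℂ (Pi.single i 1) * ψ := by
  rw [vectorAct_apply, stdB, map_zero, LinearMap.zero_apply, zero_add]

theorem topForm_six : topForm 6 = vectorAct 6 (stdB 6 0) (vectorAct 6 (stdB 6 1)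
    (vectorAct 6 (stdB 6 2) (vectorAct 6 (stdB 6 3) (vectorAct 6 (stdB 6 4)
      (vectorAct 6 (stdB 6 5) 1))))) := rfl

theorem contr_proj_ι_single_mul (i j : Fin 6) (ψ : Spinor 6) :
    contr 6 (LinearMap.proj i) (ExteriorAlgebra.ι ℂ (Pi.single j 1) * ψ) =
      (if i = j then ψ else 0) -
        ExteriorAlgebra.ι ℂ (Pi.single j 1) * contr 6 (LinearMap.proj i) ψ := by
  rw [contr_ι_mul, LinearMap.proj_apply, Pi.single_apply, ite_smul, one_smul, zero_smul]

theorem topCoeff_six (ψ : Spinor 6) : topCoeff 6 ψ = ExteriorAlgebra.algebraMapInv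
    (contr 6 (LinearMap.proj 5) (contr 6 (LinearMap.proj 4) (contr 6 (LinearMap.proj 3)
      (contr 6 (LinearMap.proj 2) (contr 6 (LinearMap.proj 1)
        (contr 6 (LinearMap.proj 0) ψ)))))) := rfl

theorem topCoeff_topForm : topCoeff 6 (topForm 6) = 1 := by
  simp [topCoeff_six, topForm_six, vectorAct_stdB, contr_proj_ι_single_mul]

theorem topCoeff_rev_topForm : topCoeff 6 (rev 6 (topForm 6)) = -1 := by
  have h : rev 6 (topForm 6) = vectorAct 6 (stdB 6 5) (vectorAct 6 (stdB 6 4)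
    (vectorAct 6 (stdB 6 3) (vectorAct 6 (stdB 6 2) (vectorAct 6 (stdB 6 1)
      (vectorAct 6 (stdB 6 0) 1))))) := by
    have hr : ∀ (x : Fin 6 → ℂ) (ψ : Spinor 6), rev 6 (ExteriorAlgebra.ι ℂ x * ψ) =
        rev 6 ψ * ExteriorAlgebra.ι ℂ x := fun x ψ => by
      rw [reverse.map_mul]
      congr 1
      exact reverse_ι x
    have h1 : rev 6 (ExteriorAlgebra.ι ℂ (Pi.single 5 1)) =
        ExteriorAlgebra.ι ℂ (Pi.single 5 1) := reverse_ι _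
    simp only [topForm_six, vectorAct_stdB, hr, mul_assoc, mul_one, h1]
  rw [h]
  simp [topCoeff_six, vectorAct_stdB, contr_proj_ι_single_mul]

theorem inner_smul_right (r : ℂ) (ψ φ : Spinor 6) : inner 6 ψ (r • φ) = r * inner 6 ψ φ := by
  simp only [inner, map_smul, mul_smul_comm, smul_eq_mul]

theorem inner_zero_left (ψ : Spinor 6) : inner 6 0 ψ = 0 := by
  simp only [inner, zero_mul, map_zero]

theorem inner_vectorAct_right (u : V 6) (ψ φ : Spinor 6) :
    inner 6 ψ (vectorAct 6 u φ) = -inner 6 (vectorAct 6 u ψ) φ := by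
  rw [inner_vectorAct_left, neg_neg]

theorem vectorAct_one (d : ℕ) (f : Module.Dual ℂ (Fin d → ℂ)) :
    vectorAct d ((f, 0) : V d) 1 = 0 := by
  rw [← mem_ann, (isFrame_one d).mem_ann_iff]
  intro i
  simp [metric_apply, stdA]

theorem vectorAct_topForm (d : ℕ) (x : Fin d → ℂ) :
    vectorAct d ((0, x) : V d) (topForm d) = 0 := by
  rw [← mem_ann, (isFrame_topForm d).mem_ann_iff]
  intro i
  simp [metric_apply, stdB]

theorem vectorAct_split (d : ℕ) (u : V d) (ψ : Spinor d) :
    vectorAct d u ψ = vectorAct d ((u.1, 0) : V d) ψ + vectorAct d ((0, u.2) : V d) ψ := by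
  rw [← LinearMap.add_apply, ← map_add]
  simp

theorem vectorAct_vectorAct_one (d : ℕ) (u v : V d) : vectorAct d u (vectorAct d v 1) =
    u.1 v.2 • (1 : Spinor d) + vectorAct d ((0, u.2) : V d) (vectorAct d ((0, v.2) : V d) 1) := by
  rw [vectorAct_split d v, vectorAct_one, zero_add, vectorAct_split d u,
    vectorAct_anticomm d (u.1, 0), vectorAct_one, map_zero, sub_zero, metric_apply]
  simp

theorem vectorAct_vectorAct_topForm (d : ℕ) (u v : V d) :
    vectorAct d u (vectorAct d v (topForm d)) = v.1 u.2 • topForm d +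
      vectorAct d ((u.1, 0) : V d) (vectorAct d ((v.1, 0) : V d) (topForm d)) := by
  rw [vectorAct_split d v, vectorAct_topForm, add_zero, vectorAct_split d u,
    vectorAct_anticomm d (0, u.2), vectorAct_topForm, map_zero, sub_zero, metric_apply, add_comm]
  simp

theorem topCoeff_one : topCoeff 6 1 = 0 := by
  simp [topCoeff_six]

theorem inner_one_vectorAct (u v : V 6) : inner 6 1 (vectorAct 6 u (vectorAct 6 v 1)) = 0 := by
  have h1 : ∀ x : Fin 6 → ℂ, vectorAct 6 ((0, x) : V 6) 1 = ExteriorAlgebra.ι ℂ x := by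
    intro x; rw [vectorAct_apply]; simp
  have h2 : ∀ (f : Module.Dual ℂ (Fin 6 → ℂ)) (x : Fin 6 → ℂ),
      contr 6 f (ExteriorAlgebra.ι ℂ x) = algebraMap ℂ _ (f x) := fun f x => contractLeft_ι _ f x
  have h4 : ∀ x y : Fin 6 → ℂ,
      topCoeff 6 (ExteriorAlgebra.ι ℂ x * ExteriorAlgebra.ι ℂ y : Spinor 6) = 0 := by
    intro x y
    have h5 : ∀ (f : Module.Dual ℂ (Fin 6 → ℂ)) (r : ℂ), contr 6 f (algebraMap ℂ _ r) = 0 :=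
      fun f r => contractLeft_algebraMap _ f r
    rw [topCoeff_six, contr_ι_mul, h2]
    simp only [map_sub, map_smul, h2, ← Algebra.commutes, ← Algebra.smul_def, h5]
    simp
  rw [vectorAct_vectorAct_one, inner_add_right, inner_smul_right, inner_vectorAct_right, h1, h1,
    inner, inner, reverse.map_one, mul_one, topCoeff_one, mul_zero, zero_add]
  rw [show rev 6 (ExteriorAlgebra.ι ℂ v.2) = ExteriorAlgebra.ι ℂ v.2 from reverse_ι _, h4, neg_zero]

theorem inner_topForm_vectorAct_one (u v : V 6) :
    inner 6 (topForm 6) (vectorAct 6 u (vectorAct 6 v 1)) = u.1 v.2 := by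
  rw [vectorAct_vectorAct_one, inner_add_right, inner_smul_right, inner_vectorAct_right,
    vectorAct_topForm, inner_zero_left, neg_zero, add_zero, inner, reverse.map_one, mul_one,
    topCoeff_topForm, mul_one]

theorem inner_one_vectorAct_topForm (u v : V 6) :
    inner 6 1 (vectorAct 6 u (vectorAct 6 v (topForm 6))) = -v.1 u.2 := by
  rw [vectorAct_vectorAct_topForm, inner_add_right, inner_smul_right, inner_vectorAct_right,
    vectorAct_one, inner_zero_left, neg_zero, add_zero, inner, one_mul,
    topCoeff_rev_topForm, mul_neg, mul_one]

theorem inner_topForm_vectorAct_topForm (u v : V 6) :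
    inner 6 (topForm 6) (vectorAct 6 u (vectorAct 6 v (topForm 6))) = 0 := by
  -- three creation operators, moved to the left factor, kill what two vectors make of the top form
  have key : ∀ (u v : V 6) (φ : Spinor 6), inner 6 (vectorAct 6 u (vectorAct 6 v (topForm 6)))
      (vectorAct 6 (stdB 6 0) (vectorAct 6 (stdB 6 1) (vectorAct 6 (stdB 6 2) φ))) = 0 := by
    intro u v φ
    have hk := (isFrame_topForm 6).kills
    rw [inner_vectorAct_right, inner_vectorAct_right, inner_vectorAct_right]
    simp only [vectorAct_anticomm 6 (stdB 6 _), hk, map_sub, map_smul, map_zero, smul_zero,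
      sub_zero, neg_zero, inner_zero_left]
  have h := key v u (vectorAct 6 (stdB 6 3) (vectorAct 6 (stdB 6 4) (vectorAct 6 (stdB 6 5) 1)))
  rw [← topForm_six] at h
  rw [inner_vectorAct_right, inner_vectorAct_right, h, neg_zero, neg_zero]

theorem B₂_one_add_topForm (u v : V 6) :
    B₂ 6 (1 + topForm 6) u v = u.1 v.2 - v.1 u.2 := by
  have h : ∀ u v : V 6, inner 6 (1 + topForm 6) (vectorAct 6 u (vectorAct 6 v (1 + topForm 6))) =
      u.1 v.2 - v.1 u.2 := by
    intro u v
    rw [map_add, map_add, inner_add_left, inner_add_right, inner_add_right, inner_one_vectorAct,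
      inner_one_vectorAct_topForm, inner_topForm_vectorAct_one, inner_topForm_vectorAct_topForm]
    ring
  rw [B₂, h, h]
  ring

theorem sum_wedge_std (u v : V 6) :
    ∑ i, wedge 6 (stdB 6 i) (stdA 6 i) u v = u.1 v.2 - v.1 u.2 := by
  have hf : ∀ (f : Module.Dual ℂ (Fin 6 → ℂ)) (x : Fin 6 → ℂ),
      f x = ∑ i, f (Pi.single i 1) * x i := by
    intro f x
    conv_lhs => rw [← (Pi.basisFun ℂ (Fin 6)).sum_repr x]
    simp [mul_comm]
  rw [hf u.1, hf v.1, ← Finset.sum_sub_distrib]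
  refine Finset.sum_congr rfl fun i _ => ?_
  simp [wedge, metric_apply, stdA, stdB]

/-! ### The stabiliser of the standard pair -/

/-- The stabiliser of `1 + e^1 ∧ ⋯ ∧ e^6`. -/
abbrev stdStabilizer : Subgroup (Spin 6) := spinStabilizer 6 (1 + topForm 6)

theorem mem_stdStabilizer {g : Spin 6} :
    g ∈ stdStabilizer ↔ spinAct 6 g (1 + topForm 6) = 1 + topForm 6 := Iff.rfl

/-- The stabiliser preserves the 2-form as well as the metric, hence the pairing between the two
null subspaces. -/
theorem vecAct_fst_snd {g : Spin 6} (hg : g ∈ stdStabilizer) (u v : V 6) :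
    (vecAct g u).1 (vecAct g v).2 = u.1 v.2 := by
  have h1 := B₂_spinAct g (1 + topForm 6) u v
  rw [mem_stdStabilizer.1 hg, B₂_one_add_topForm, B₂_one_add_topForm] at h1
  have h2 := metric_vecAct g u v
  rw [metric_apply, metric_apply] at h2
  linear_combination (h1 + h2) / 2

theorem vecAct_snd_eq_zero {g : Spin 6} (hg : g ∈ stdStabilizer) {u : V 6} (hu : u.2 = 0) :
    (vecAct g u).2 = 0 := by
  funext i
  have h := vecAct_fst_snd hg (vecAct g⁻¹ (stdA 6 i)) u
  rw [vecAct_vecAct_inv, hu, map_zero] at h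
  exact h

theorem vecAct_fst_eq_zero {g : Spin 6} (hg : g ∈ stdStabilizer) {u : V 6} (hu : u.1 = 0) :
    (vecAct g u).1 = 0 := by
  refine LinearMap.ext fun y => ?_
  have h := vecAct_fst_snd hg u (vecAct g⁻¹ (0, y))
  rw [vecAct_vecAct_inv, hu, LinearMap.zero_apply] at h
  exact h

theorem vectorAct_one_of_snd {d : ℕ} {u : V d} (hu : u.2 = 0) : vectorAct d u 1 = 0 := by
  obtain ⟨f, x⟩ := u
  subst hu
  exact vectorAct_one d f

theorem vectorAct_topForm_of_fst {d : ℕ} {u : V d} (hu : u.1 = 0) :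
    vectorAct d u (topForm d) = 0 := by
  obtain ⟨f, x⟩ := u
  subst hu
  exact vectorAct_topForm d x

/-- The stabiliser fixes both summands: each is an eigenvector by uniqueness of the vacuum. -/
theorem spinAct_one_and_topForm {g : Spin 6} (hg : g ∈ stdStabilizer) :
    spinAct 6 g 1 = 1 ∧ spinAct 6 g (topForm 6) = topForm 6 := by
  have hg' : g⁻¹ ∈ stdStabilizer := stdStabilizer.inv_mem hg
  obtain ⟨r, hr⟩ := (isFrame_one 6).exists_smul (χ' := spinAct 6 g 1) fun i => by
    rw [← vecAct_vecAct_inv g (stdA 6 i), vectorAct_vecAct,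
      vectorAct_one_of_snd (vecAct_snd_eq_zero hg' rfl), spinAct_eq_zero_iff]
  obtain ⟨r', hr'⟩ := (isFrame_topForm 6).exists_smul (χ' := spinAct 6 g (topForm 6)) fun i => by
    rw [← vecAct_vecAct_inv g (stdB 6 i), vectorAct_vecAct,
      vectorAct_topForm_of_fst (vecAct_fst_eq_zero hg' rfl), spinAct_eq_zero_iff]
  have h := mem_stdStabilizer.1 hg
  rw [spinAct_add, hr, hr'] at h
  have h1 := congrArg (topCoeff 6) h
  rw [map_add, map_add, map_smul, map_smul, topCoeff_one, topCoeff_topForm, smul_zero, zero_add,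
    zero_add, smul_eq_mul, mul_one] at h1
  rw [h1, one_smul, add_left_inj] at h
  rw [hr, hr', h1, one_smul]
  exact ⟨h, rfl⟩

/-- The matrix of a spin transformation on the span of the `e_i*`. -/
def vecMatrix (g : Spin 6) : Matrix (Fin 6) (Fin 6) ℂ :=
  Matrix.of fun j i => metric 6 (vecAct g (stdA 6 i)) (stdB 6 j)

theorem vecAct_stdA {g : Spin 6} (hg : g ∈ stdStabilizer) (i : Fin 6) :
    vecAct g (stdA 6 i) = ∑ j, vecMatrix g j i • stdA 6 j := by
  rw [(isCanonicalBasis_std 6).expand (vecAct g (stdA 6 i))]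
  refine Finset.sum_congr rfl fun j _ => ?_
  have h : metric 6 (vecAct g (stdA 6 i)) (stdA 6 j) = 0 := by
    rw [metric_apply, vecAct_snd_eq_zero hg rfl]
    simp [stdA]
  rw [h, zero_smul, add_zero]
  rfl

theorem vecAct_stdB {g : Spin 6} (hg : g ∈ stdStabilizer) (i : Fin 6) :
    vecAct g (stdB 6 i) = ∑ j, vecMatrix g⁻¹ i j • stdB 6 j := by
  rw [(isCanonicalBasis_std 6).expand (vecAct g (stdB 6 i))]
  refine Finset.sum_congr rfl fun j _ => ?_
  have h : metric 6 (vecAct g (stdB 6 i)) (stdB 6 j) = 0 := by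
    rw [metric_apply, vecAct_fst_eq_zero hg rfl]
    simp [stdB]
  have h' : metric 6 (vecAct g (stdB 6 i)) (stdA 6 j) = vecMatrix g⁻¹ i j := by
    rw [← metric_vecAct g⁻¹, vecAct_inv_vecAct, metric_comm]
    rfl
  rw [h, h', zero_smul, zero_add]

theorem vecMatrix_mul (g : Spin 6) {g' : Spin 6} (hg' : g' ∈ stdStabilizer) :
    vecMatrix (g * g') = vecMatrix g * vecMatrix g' := by
  ext j i
  rw [Matrix.mul_apply]
  change metric 6 (vecAct (g * g') (stdA 6 i)) (stdB 6 j) = _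
  rw [vecAct_mul, vecAct_stdA hg', map_sum, metric_sum_left]
  refine Finset.sum_congr rfl fun k _ => ?_
  rw [map_smul, metric_smul_left, mul_comm]
  rfl

theorem vecMatrix_one : vecMatrix 1 = 1 := by
  ext j i
  change metric 6 (vecAct 1 (stdA 6 i)) (stdB 6 j) = _
  rw [vecAct_one, (isCanonicalBasis_std 6).pairing, Matrix.one_apply]
  simp only [eq_comm]

theorem spinAct_listSpinor {d : ℕ} (g : Spin d) (a' : Fin d → V d) (χ : Spinor d)
    (l : List (Fin d)) : spinAct d g (listSpinor d a' χ l) =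
      listSpinor d (fun i => vecAct g (a' i)) (spinAct d g χ) l := by
  induction l with
  | nil => rfl
  | cons j l ih =>
    exact (vectorAct_vecAct g (a' j) _).symm.trans (congrArg (vectorAct d (vecAct g (a' j))) ih)

theorem listSpinor_smul {d : ℕ} (a' : Fin d → V d) (r : ℂ) (χ : Spinor d) (l : List (Fin d)) :
    listSpinor d a' (r • χ) l = r • listSpinor d a' χ l := by
  induction l with
  | nil => rfl
  | cons j l ih =>
    refine (congrArg (vectorAct d (a' j)) ih).trans ?_
    rw [map_smul]
    rfl

theorem listSpinor_eq_ιMulti (x : Fin 6 → Fin 6 → ℂ) :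
    listSpinor 6 (fun i => ((0, x i) : V 6)) 1 (List.finRange 6) =
      ExteriorAlgebra.ιMulti ℂ 6 x := by
  have h : ∀ (y : Fin 6 → ℂ) (ψ : Spinor 6),
      vectorAct 6 ((0, y) : V 6) ψ = ExteriorAlgebra.ι ℂ y * ψ := by
    intro y ψ
    rw [vectorAct_apply, map_zero, LinearMap.zero_apply, zero_add]
  have hl : List.finRange 6 = [0, 1, 2, 3, 4, 5] := rfl
  rw [ExteriorAlgebra.ιMulti_apply, hl]
  simp only [listSpinor, List.foldr_cons, List.foldr_nil, h]
  simp only [List.ofFn_succ, List.ofFn_zero, List.prod_cons, List.prod_nil]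
  rfl

/-- The top coefficient of a product of six vectors is the determinant. -/
theorem topCoeff_listSpinor (x : Matrix (Fin 6) (Fin 6) ℂ) :
    topCoeff 6 (listSpinor 6 (fun i => ((0, x i) : V 6)) 1 (List.finRange 6)) = x.det := by
  have h := ((topCoeff 6).compAlternatingMap
    (ExteriorAlgebra.ιMulti ℂ 6)).eq_smul_basis_det (Pi.basisFun ℂ (Fin 6))
  have h1 : topCoeff 6 (ExteriorAlgebra.ιMulti ℂ 6 (Pi.basisFun ℂ (Fin 6))) = 1 := by
    rw [← topCoeff_topForm, ← listSpinor_eq_ιMulti]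
    congr 3
    funext i
    rw [Pi.basisFun_apply]
    rfl
  rw [LinearMap.compAlternatingMap_apply, h1, one_smul] at h
  exact (congrArg (topCoeff 6) (listSpinor_eq_ιMulti x)).trans
    ((DFunLike.congr_fun h _).trans (Pi.basisFun_det_apply x))

theorem sum_smul_stdB (x : Fin 6 → ℂ) : ∑ j, x j • stdB 6 j = ((0, x) : V 6) := by
  refine Prod.ext ?_ ?_
  · simp [stdB, Prod.fst_sum]
  · funext i
    simp [stdB, Prod.snd_sum, Pi.single_apply]

/-- The determinant is one because the top form is fixed. -/
theorem det_vecMatrix {g : Spin 6} (hg : g ∈ stdStabilizer) : (vecMatrix g).det = 1 := by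
  have key : ∀ {g : Spin 6}, g ∈ stdStabilizer → (vecMatrix g⁻¹).det = 1 := by
    intro g hg
    obtain ⟨h1, h2⟩ := spinAct_one_and_topForm hg
    have h3 := congrArg (topCoeff 6) h2
    rw [topForm, spinAct_listSpinor, h1, ← topForm, topCoeff_topForm] at h3
    simp only [vecAct_stdB hg, sum_smul_stdB] at h3
    exact (topCoeff_listSpinor (vecMatrix g⁻¹)).symm.trans h3
  have := key (stdStabilizer.inv_mem hg)
  rwa [inv_inv] at this

/-- The action of the stabiliser on the span of the `e_i*`. -/
def stabilizerToSL : stdStabilizer →* Matrix.SpecialLinearGroup (Fin 6) ℂ where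
  toFun g := ⟨vecMatrix g, det_vecMatrix g.2⟩
  map_one' := Subtype.ext vecMatrix_one
  map_mul' g g' := Subtype.ext (vecMatrix_mul g g'.2)

/-- An element of the stabiliser fixing all vectors is a scalar in the Clifford algebra, and the
scalar is `1` as it fixes the spinor `1`. -/
theorem stabilizerToSL_injective : Function.Injective stabilizerToSL := by
  refine (injective_iff_map_eq_one _).2 fun g hg => ?_
  have h1 : vecMatrix g = 1 := congrArg Subtype.val hg
  have h2 : vecMatrix (g : Spin 6)⁻¹ = 1 := by
    have := vecMatrix_mul (g : Spin 6)⁻¹ g.2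
    rwa [h1, mul_one, inv_mul_cancel, vecMatrix_one, eq_comm] at this
  have hA : ∀ i, vecAct (g : Spin 6) (stdA 6 i) = stdA 6 i := fun i => by
    rw [vecAct_stdA g.2, h1]
    simp [Matrix.one_apply]
  have hB : ∀ i, vecAct (g : Spin 6) (stdB 6 i) = stdB 6 i := fun i => by
    rw [vecAct_stdB g.2, h2]
    simp [Matrix.one_apply]
  have hv : ∀ v, vecAct (g : Spin 6) v = v := fun v => by
    conv_lhs => rw [(isCanonicalBasis_std 6).expand v]
    simp only [map_sum, map_add, map_smul, hA, hB]
    exact ((isCanonicalBasis_std 6).expand v).symm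
  obtain ⟨r, hr⟩ := mem_range_algebraMap_of_commute (Q 6) (Module.finBasis ℂ (V 6))
    (polarBilin_surjective 6) (spinGroup.involute_eq (g : Spin 6).2) fun v => by
      conv_lhs => rw [← hv v, ι_vecAct]
      rw [mul_assoc, coe_inv_mul, mul_one]
  have h3 := (spinAct_one_and_topForm g.2).1
  rw [spinAct, hr, AlgHom.commutes, Module.algebraMap_end_apply] at h3
  have h4 : r = 1 := by
    have : (r - 1) • (1 : Spinor 6) = 0 := by rw [sub_smul, h3, one_smul, sub_self]
    exact sub_eq_zero.1 ((smul_eq_zero.1 this).resolve_right one_ne_zero)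
  refine Subtype.ext (Subtype.ext ?_)
  rw [hr, h4, map_one]
  rfl

theorem exists_spin_coe_eq_neg_one (d : ℕ) (hd : 0 < d) :
    ∃ z : Spin d, (z : CliffordAlgebra (Q d)) = -1 := by
  have hu : Q d ((LinearMap.proj (⟨0, hd⟩ : Fin d), Pi.single ⟨0, hd⟩ (-1)) : V d) = -1 := by
    simp [QuadraticForm.dualProd_apply]
  have h := ι_mem_pinGroup hu
  have hsq := ι_sq_scalar (Q d)
    ((LinearMap.proj (⟨0, hd⟩ : Fin d), Pi.single ⟨0, hd⟩ (-1)) : V d)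
  rw [hu, map_neg, map_one] at hsq
  exact ⟨⟨_, Submonoid.mul_mem _ h h, ι_mul_ι_mem_evenOdd_zero _ _ _⟩, hsq⟩

/-- A matrix of determinant one carries the standard canonical basis to another one with vacuum `1`.
The spin element between the two frames scales `1` and the top form by the same sign. -/
theorem stabilizerToSL_surjective : Function.Surjective stabilizerToSL := by
  intro h
  have hinv : h⁻¹.1 * h.1 = 1 := by
    rw [← Matrix.SpecialLinearGroup.coe_mul, inv_mul_cancel, Matrix.SpecialLinearGroup.coe_one]
  have hinv' : h.1 * h⁻¹.1 = 1 := by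
    rw [← Matrix.SpecialLinearGroup.coe_mul, mul_inv_cancel, Matrix.SpecialLinearGroup.coe_one]
  have hs := isCanonicalBasis_std 6
  have hc : IsCanonicalBasis 6 (fun i => ∑ j, h.1 j i • stdA 6 j)
      fun i => ∑ j, h⁻¹.1 i j • stdB 6 j := by
    refine ⟨fun i j => ?_, fun i j => ?_, fun i j => ?_⟩
    · simp [metric_sum_left, metric_sum_right, hs.null]
    · simp [metric_sum_left, metric_sum_right, hs.null']
    · have := congrFun (congrFun hinv j) i
      rw [Matrix.mul_apply, Matrix.one_apply] at this
      simp only [metric_sum_left, metric_sum_right, metric_smul_left, metric_smul_right,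
        hs.pairing, mul_ite, mul_one, mul_zero, Finset.sum_ite_eq',
        Finset.mem_univ, if_true]
      simp only [eq_comm (a := i), ← this, mul_comm]
  have hf : IsFrame 6 (fun i => ∑ j, h.1 j i • stdA 6 j) (fun i => ∑ j, h⁻¹.1 i j • stdB 6 j) 1 :=
    ⟨hc, one_ne_zero, fun i => by
      rw [map_sum, LinearMap.sum_apply]
      refine Finset.sum_eq_zero fun j _ => ?_
      rw [map_smul, LinearMap.smul_apply, (isFrame_one 6).kills, smul_zero]⟩
  obtain ⟨g, hgA, hgB, r, hr, hg1⟩ := (isFrame_one 6).exists_spin hf (one_mem_semiSpinor 6)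
    (one_mem_semiSpinor 6)
  -- the top form is multiplied by `r * det h⁻¹ = r`
  obtain ⟨r', hgT⟩ := (isFrame_topForm 6).exists_smul (χ' := spinAct 6 g (topForm 6)) fun k => by
    have hk : stdB 6 k = vecAct g (∑ i, h.1 k i • stdB 6 i) := by
      rw [map_sum]
      simp only [map_smul, hgB, Finset.smul_sum, smul_smul]
      rw [Finset.sum_comm]
      simp only [← Finset.sum_smul, ← Matrix.mul_apply, hinv']
      simp [Matrix.one_apply]
    rw [hk, vectorAct_vecAct, sum_smul_stdB, vectorAct_topForm, spinAct_eq_zero_iff]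
  have hrr : r' = r := by
    have h1 := congrArg (topCoeff 6) hgT
    rw [map_smul, topCoeff_topForm, topForm, spinAct_listSpinor, hg1, listSpinor_smul, map_smul,
      smul_eq_mul, smul_eq_mul, mul_one] at h1
    simp only [hgB, sum_smul_stdB] at h1
    have h2 := topCoeff_listSpinor h⁻¹.1
    rw [h⁻¹.2] at h2
    exact h1.symm.trans ((congrArg (r * ·) h2).trans (mul_one r))
  -- invariance of the inner product leaves the sign of `r` free
  have hr2 : r = 1 ∨ r = -1 := by
    have h1 := inner_spinAct g 1 (topForm 6)
    rw [hg1, hgT, hrr, inner_smul_right] at h1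
    simp only [inner, smul_mul_assoc, one_mul, map_smul, smul_eq_mul, topCoeff_rev_topForm] at h1
    have h2 : (r - 1) * (r + 1) = 0 := by linear_combination -h1
    rcases mul_eq_zero.1 h2 with h3 | h3
    · exact Or.inl (sub_eq_zero.1 h3)
    · exact Or.inr (eq_neg_of_add_eq_zero_left h3)
  obtain ⟨g', hgA', hg'⟩ : ∃ g' : Spin 6, (∀ i, vecAct g' (stdA 6 i) = ∑ j, h.1 j i • stdA 6 j) ∧
      spinAct 6 g' (1 + topForm 6) = 1 + topForm 6 := by
    rw [hrr] at hgT
    rcases hr2 with rfl | rfl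
    · exact ⟨g, hgA, by rw [spinAct_add, hg1, hgT, one_smul, one_smul]⟩
    · obtain ⟨z, hz⟩ := exists_spin_coe_eq_neg_one 6 (by norm_num)
      refine ⟨z * g, fun i => ?_, ?_⟩
      · rw [vecAct_mul, hgA]
        exact vecAct_eq_of_mul_eq (by rw [hz]; noncomm_ring)
      · rw [spinAct_mul, spinAct_add, hg1, hgT, ← smul_add, spinAct, hz, map_neg, map_one,
          LinearMap.neg_apply, Module.End.one_apply, neg_smul, one_smul, neg_neg]
  refine ⟨⟨g', hg'⟩, Subtype.ext (Matrix.ext fun j i => ?_)⟩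
  change metric 6 (vecAct g' (stdA 6 i)) (stdB 6 j) = h.1 j i
  rw [hgA', metric_sum_left]
  simp [hs.pairing]

/-- The stabiliser of the standard pair is `SL(6)`. -/
def slEquivStabilizer : Matrix.SpecialLinearGroup (Fin 6) ℂ ≃* stdStabilizer :=
  (MulEquiv.ofBijective stabilizerToSL
    ⟨stabilizerToSL_injective, stabilizerToSL_surjective⟩).symm

theorem vecMatrix_slEquivStabilizer (h : Matrix.SpecialLinearGroup (Fin 6) ℂ) :
    vecMatrix (slEquivStabilizer h) = h.1 :=
  congrArg Subtype.val ((MulEquiv.ofBijective stabilizerToSL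
    ⟨stabilizerToSL_injective, stabilizerToSL_surjective⟩).apply_symm_apply h)

theorem vecAct_slEquivStabilizer_stdA (h : Matrix.SpecialLinearGroup (Fin 6) ℂ) (i : Fin 6) :
    vecAct (slEquivStabilizer h : Spin 6) (stdA 6 i) = ∑ j, h.1 j i • stdA 6 j := by
  rw [vecAct_stdA (slEquivStabilizer h).2, vecMatrix_slEquivStabilizer]

theorem vecAct_slEquivStabilizer_stdB (h : Matrix.SpecialLinearGroup (Fin 6) ℂ) (i : Fin 6) :
    vecAct (slEquivStabilizer h : Spin 6) (stdB 6 i) = ∑ j, (h⁻¹).1 i j • stdB 6 j := by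
  have h1 : (slEquivStabilizer h : Spin 6)⁻¹ = (slEquivStabilizer h⁻¹ : Spin 6) := by
    rw [map_inv]; rfl
  rw [vecAct_stdB (slEquivStabilizer h).2, h1, vecMatrix_slEquivStabilizer]

/-! ### Orbits and stabilisers of sums of two complementary pure spinors -/

/-- Up to scale, a sum of two complementary pure spinors is `1 + e^1 ∧ ⋯ ∧ e^d`. -/
theorem exists_spinAct_add {d : ℕ} (hd : 0 < d) {φA φB : Spinor d}
    (hA : φA ∈ semiSpinor d) (pA : IsPure d φA) (pB : IsPure d φB)
    (hAB : ann d φA ⊓ ann d φB = ⊥) : ∃ g : Spin d, ∃ s : ℂ, s ≠ 0 ∧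
      spinAct d g (φA + φB) = s • (1 + topForm d) := by
  obtain ⟨g, s, hs, h1, h2⟩ := exists_spinAct_eq_one_topForm hd hA pA pB hAB
  exact ⟨g, s, hs, by rw [spinAct_add, h1, h2, smul_add]⟩

theorem exists_B₂_eq_sum_wedge {ψ : Spinor 6} {g : Spin 6} {s : ℂ} (hs : s ≠ 0)
    (h : spinAct 6 g ψ = s • (1 + topForm 6)) :
    ∃ (b b' : Fin 6 → V 6) (μ : ℂ), IsCanonicalBasis 6 b b' ∧ μ ≠ 0 ∧
      ∀ u v : V 6, B₂ 6 ψ u v = μ * ∑ i, wedge 6 (b' i) (b i) u v := by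
  refine ⟨fun i => vecAct g⁻¹ (stdA 6 i), fun i => vecAct g⁻¹ (stdB 6 i), s ^ 2,
    (isCanonicalBasis_std 6).vecAct g⁻¹, pow_ne_zero 2 hs, fun u v => ?_⟩
  rw [← B₂_spinAct g, h, B₂_smul, B₂_one_add_topForm, ← sum_wedge_std]
  congr 1
  refine Finset.sum_congr rfl fun i _ => ?_
  rw [← wedge_vecAct g⁻¹, vecAct_inv_vecAct, vecAct_inv_vecAct]

theorem exists_spinAct_eq_smul {d : ℕ} {ψ φ : Spinor d} {χ : Spinor d} {g g' : Spin d} {s s' : ℂ}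
    (hs : s ≠ 0) (hs' : s' ≠ 0) (h : spinAct d g ψ = s • χ) (h' : spinAct d g' φ = s' • χ) :
    ∃ r : ℂ, r ≠ 0 ∧ ∃ k : Spin d, spinAct d k ψ = r • φ := by
  refine ⟨s / s', div_ne_zero hs hs', g'⁻¹ * g, ?_⟩
  have h1 : χ = s'⁻¹ • spinAct d g' φ := by rw [h', smul_smul, inv_mul_cancel₀ hs', one_smul]
  rw [spinAct_mul, h, h1, smul_smul, spinAct_smul, spinAct_inv_spinAct, div_eq_mul_inv]

theorem conj_mem_spinStabilizer {d : ℕ} {ψ χ : Spinor d} {g : Spin d} {s : ℂ} (hs : s ≠ 0)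
    (h : spinAct d g ψ = s • χ) (k : Spin d) :
    g⁻¹ * k * g ∈ spinStabilizer d ψ ↔ k ∈ spinStabilizer d χ := by
  change spinAct d (g⁻¹ * k * g) ψ = ψ ↔ spinAct d k χ = χ
  rw [spinAct_mul, h, spinAct_smul, spinAct_mul]
  have h1 : ψ = s • spinAct d g⁻¹ χ := by rw [← spinAct_smul, ← h, spinAct_inv_spinAct]
  constructor
  · intro h2
    rw [h1] at h2
    have h3 := congrArg (spinAct d g) (smul_right_injective _ hs h2)
    rwa [spinAct_spinAct_inv, spinAct_spinAct_inv] at h3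
  · intro h2
    rw [h2]
    exact h1.symm

/-- Conjugation carries the stabiliser of a spinor to that of a proportional transform of it. -/
def stabilizerConj {d : ℕ} {ψ χ : Spinor d} {g : Spin d} {s : ℂ} (hs : s ≠ 0)
    (h : spinAct d g ψ = s • χ) : spinStabilizer d χ ≃* spinStabilizer d ψ where
  toFun k := ⟨g⁻¹ * k * g, (conj_mem_spinStabilizer hs h k).2 k.2⟩
  invFun k := ⟨g * k * g⁻¹, (conj_mem_spinStabilizer hs h _).1 (by
    rw [show g⁻¹ * (g * (k : Spin d) * g⁻¹) * g = k by group]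
    exact k.2)⟩
  left_inv k := Subtype.ext (by
    change g * (g⁻¹ * (k : Spin d) * g) * g⁻¹ = k
    group)
  right_inv k := Subtype.ext (by
    change g⁻¹ * (g * (k : Spin d) * g⁻¹) * g = k
    group)
  map_mul' k k' := Subtype.ext (by
    change g⁻¹ * ((k : Spin d) * k') * g = g⁻¹ * k * g * (g⁻¹ * k' * g)
    group)

theorem vecAct_conj {d : ℕ} (g k : Spin d) (u : V d) :
    vecAct (g⁻¹ * k * g) (vecAct g⁻¹ u) = vecAct g⁻¹ (vecAct k u) := by
  rw [vecAct_mul, vecAct_vecAct_inv, vecAct_mul]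

theorem exists_slEquiv_spinStabilizer {φA φB : Spinor 6} (hA : φA ∈ semiSpinor 6)
    (pA : IsPure 6 φA) (pB : IsPure 6 φB) (hAB : ann 6 φA ⊓ ann 6 φB = ⊥) :
    ∃ a a' : Fin 6 → V 6, IsCanonicalBasis 6 a a' ∧
      ann 6 φA = Submodule.span ℂ (Set.range a) ∧ ann 6 φB = Submodule.span ℂ (Set.range a') ∧
      ∃ e : Matrix.SpecialLinearGroup (Fin 6) ℂ ≃* spinStabilizer 6 (φA + φB),
        ∀ (h : Matrix.SpecialLinearGroup (Fin 6) ℂ) (i : Fin 6),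
          vecAct (e h : Spin 6) (a i) = ∑ j, h.1 j i • a j ∧
          vecAct (e h : Spin 6) (a' i) = ∑ j, (h⁻¹).1 i j • a' j := by
  obtain ⟨g, s, hs, h1, h2⟩ := exists_spinAct_eq_one_topForm (by norm_num) hA pA pB hAB
  have hsum : spinAct 6 g (φA + φB) = s • (1 + topForm 6) := by
    rw [spinAct_add, h1, h2, smul_add]
  have hc := (isCanonicalBasis_std 6).vecAct g⁻¹
  have kill : ∀ (u : V 6) (φ χ : Spinor 6), spinAct 6 g φ = s • χ → vectorAct 6 u χ = 0 →
      vectorAct 6 (vecAct g⁻¹ u) φ = 0 := by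
    intro u φ χ hφ hu
    rw [← spinAct_inv_spinAct g φ, vectorAct_vecAct, hφ, map_smul, hu, smul_zero]
    exact map_zero _
  have fA : IsFrame 6 (fun i => vecAct g⁻¹ (stdA 6 i)) (fun i => vecAct g⁻¹ (stdB 6 i)) φA :=
    ⟨hc, pA.1, fun i => kill _ _ _ h1 ((isFrame_one 6).kills i)⟩
  have fB : IsFrame 6 (fun i => vecAct g⁻¹ (stdB 6 i)) (fun i => vecAct g⁻¹ (stdA 6 i)) φB :=
    ⟨(isFrame_topForm 6).basis.vecAct g⁻¹, pB.1,
      fun i => kill _ _ _ h2 ((isFrame_topForm 6).kills i)⟩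
  refine ⟨_, _, hc, fA.ann_eq, fB.ann_eq, slEquivStabilizer.trans (stabilizerConj hs hsum),
    fun h i => ⟨?_, ?_⟩⟩
  · exact (vecAct_conj g _ _).trans ((congrArg (vecAct g⁻¹)
      (vecAct_slEquivStabilizer_stdA h i)).trans (by simp only [map_sum, map_smul]))
  · exact (vecAct_conj g _ _).trans ((congrArg (vecAct g⁻¹)
      (vecAct_slEquivStabilizer_stdB h i)).trans (by simp only [map_sum, map_smul]))

end SpinorOrbits

end

theorem mainTheorem3 :
    -- four pure spinors in twelve dimensions
    (∀ ψ : Fin 4 → SpinorOrbits.Spinor 6, SpinorOrbits.IsConfiguration 6 ψ →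
      -- all edges are two-dimensional and no direction is shared by three of the annihilators
      (∀ α β, α ≠ β → Module.finrank ℂ
        (SpinorOrbits.ann 6 (ψ α) ⊓ SpinorOrbits.ann 6 (ψ β) :
          Submodule ℂ (SpinorOrbits.V 6)) = 2) ∧
      (∀ α β γ, α ≠ β → α ≠ γ → β ≠ γ →
        SpinorOrbits.ann 6 (ψ α) ⊓ SpinorOrbits.ann 6 (ψ β) ⊓ SpinorOrbits.ann 6 (ψ γ) = ⊥) ∧
      ∀ c : Fin 4 → ℂ, (∀ α, c α ≠ 0) →
        -- the 2-form becomes standard in another canonical basis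
        (∃ (b b' : Fin 6 → SpinorOrbits.V 6) (μ : ℂ), SpinorOrbits.IsCanonicalBasis 6 b b' ∧
          μ ≠ 0 ∧ ∀ u v : SpinorOrbits.V 6, SpinorOrbits.B₂ 6 (∑ α, c α • ψ α) u v =
            μ * ∑ i, SpinorOrbits.wedge 6 (b' i) (b i) u v) ∧
        -- up to scale, the orbit is that of any sum of two complementary pure spinors
        (∀ φA ∈ SpinorOrbits.semiSpinor 6, ∀ φB ∈ SpinorOrbits.semiSpinor 6,
          SpinorOrbits.IsPure 6 φA → SpinorOrbits.IsPure 6 φB →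
          SpinorOrbits.ann 6 φA ⊓ SpinorOrbits.ann 6 φB = ⊥ →
          ∃ s : ℂ, s ≠ 0 ∧ ∃ g : SpinorOrbits.Spin 6,
            SpinorOrbits.spinAct 6 g (∑ α, c α • ψ α) = s • (φA + φB))) ∧
    -- the stabiliser of a sum of two complementary pure spinors is `SL(6)`
    (∀ φA ∈ SpinorOrbits.semiSpinor 6, ∀ φB ∈ SpinorOrbits.semiSpinor 6,
      SpinorOrbits.IsPure 6 φA → SpinorOrbits.IsPure 6 φB →
      SpinorOrbits.ann 6 φA ⊓ SpinorOrbits.ann 6 φB = ⊥ →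
      ∃ a a' : Fin 6 → SpinorOrbits.V 6, SpinorOrbits.IsCanonicalBasis 6 a a' ∧
        SpinorOrbits.ann 6 φA = Submodule.span ℂ (Set.range a) ∧
        SpinorOrbits.ann 6 φB = Submodule.span ℂ (Set.range a') ∧
        ∃ e : Matrix.SpecialLinearGroup (Fin 6) ℂ ≃*
            SpinorOrbits.spinStabilizer 6 (φA + φB),
          ∀ (h : Matrix.SpecialLinearGroup (Fin 6) ℂ) (i : Fin 6),
            (((e h : SpinorOrbits.Spin 6) : CliffordAlgebra (SpinorOrbits.Q 6)) *
                CliffordAlgebra.ι (SpinorOrbits.Q 6) (a i) *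
                (((e h)⁻¹ : SpinorOrbits.Spin 6) : CliffordAlgebra (SpinorOrbits.Q 6)) =
              CliffordAlgebra.ι (SpinorOrbits.Q 6) (∑ j, h.1 j i • a j)) ∧
            (((e h : SpinorOrbits.Spin 6) : CliffordAlgebra (SpinorOrbits.Q 6)) *
                CliffordAlgebra.ι (SpinorOrbits.Q 6) (a' i) *
                (((e h)⁻¹ : SpinorOrbits.Spin 6) : CliffordAlgebra (SpinorOrbits.Q 6)) =
              CliffordAlgebra.ι (SpinorOrbits.Q 6) (∑ j, (h⁻¹).1 i j • a' j))) ∧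
    -- tetrahedral intersection numbers of irreducible combinations
    (∀ (d k : ℕ) (ψ : Fin k → SpinorOrbits.Spinor d), SpinorOrbits.IsConfiguration d ψ →
      ∀ c : Fin k → ℂ, (∀ α, c α ≠ 0) → ¬ SpinorOrbits.IsReducible d ψ c →
      ∀ α β γ δ : Fin k, α ≠ β → α ≠ γ → α ≠ δ → β ≠ γ → β ≠ δ → γ ≠ δ →
        Module.finrank ℂ
          (SpinorOrbits.ann d (ψ α) ⊓ SpinorOrbits.ann d (ψ β) ⊓ SpinorOrbits.ann d (ψ γ) ⊓
            SpinorOrbits.ann d (ψ δ) : Submodule ℂ (SpinorOrbits.V d)) + 7 ≤ d) := by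
  refine ⟨fun ψ h => ⟨fun α β hαβ => h.finrank_inf_eq_two hαβ,
    fun α β γ hαβ hαγ hβγ => h.inf_inf_eq_bot hαβ hαγ hβγ, fun c hc => ?_⟩,
    fun φA hA φB _ pA pB hAB => ?_, fun d k ψ h c hc hirr α β γ δ hαβ hαγ hαδ hβγ hβδ hγδ => ?_⟩
  · obtain ⟨φ₁, φ₂, ⟨m₁, p₁⟩, ⟨-, p₂⟩, h12, hsum⟩ := h.exists_eq_add hc
    obtain ⟨g, s, hs, hg⟩ := SpinorOrbits.exists_spinAct_add (by norm_num) m₁ p₁ p₂ h12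
    rw [hsum]
    refine ⟨SpinorOrbits.exists_B₂_eq_sum_wedge hs hg, fun φA hA φB _ pA pB hAB => ?_⟩
    obtain ⟨g', s', hs', hg'⟩ := SpinorOrbits.exists_spinAct_add (by norm_num) hA pA pB hAB
    exact SpinorOrbits.exists_spinAct_eq_smul hs hs' hg hg'
  · obtain ⟨a, a', hc, hφA, hφB, e, he⟩ :=
      SpinorOrbits.exists_slEquiv_spinStabilizer hA pA pB hAB
    exact ⟨a, a', hc, hφA, hφB, e, fun h i => ⟨(SpinorOrbits.ι_vecAct _ _).symm.trans
      (congrArg _ (he h i).1), (SpinorOrbits.ι_vecAct _ _).symm.trans (congrArg _ (he h i).2)⟩⟩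
  · by_contra ht
    exact hirr (h.isReducible hc hαβ hαγ hαδ hβγ hβδ hγδ (by omega))
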